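/- Let $S_n$ be the set of permutations of $[n]=\{1,\dots,n\}$. **The random permutations.** Let $g:[0,1]\to\mathbb R$ be a strictly decreasing $C^1$ function with $g(0)=1$, $g(1)=0$. For $n\ge 1$ and $i\in[n]$ let $C^{(n),i}$, $i\in[n]$, be independent random variables with $$\mathbb P\big(C^{(n),i}=l\big)=\frac{g\big(\frac{(i-1)+(l-1)}{n}\big)-g\big(\frac{(i-1)+l}{n}\big)}{g\big(\frac{i-1}{n}\big)},\qquad l=1,\dots,n-(i-1).$$ Put $D_1=[n]$ and, for $i=1,\dots,n$, let $\sigma_n(i)$ be the $C^{(n),i}$-th smallest element of $D_i$ and $D_{i+1}=D_i\setminus\{\sigma_n(i)\}$. Any random element $\sigma_n$ of $S_n$ with the law of the permutation so generated is called $g$-random, $\sigma_n\sim\mathrm{PERM}(g,n)$. The $k$-card-minimum model ($k\ge1$) is the same procedure with $C^{(n),i}$ distributed as the minimum of $k$ independent uniform elements of $\{1,\dots,n-(i-1)\}$. **The limit.** Let $u(x)=\int_0^x\frac{dz}{g(z)}$ for $x\in[0,1)$, which is a bijection $[0,1)\to[0,\infty)$; put $V_g(x,y)=u^{-1}(u(x)+u(y))$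 for $x,y\in[0,1)$ and $V_g(x,y)=1$ if $x=1$ or $y=1$. Let $\mu_g$ be the measure on $[0,1]^2$ with density $$f_g(x,y)=\frac{-g'(V_g(x,y))\,g(V_g(x,y))}{g(x)g(y)},\qquad x,y\in[0,1).$$ **Pattern densities.** For $\tau\in S_k$, $\sigma\in S_n$ and $k\le n$, $t(\tau,\sigma)$ is the fraction of the $k$-tuples $1\le i_1<\dots<i_k\le n$ for which $\sigma(i_1),\dots,\sigma(i_k)$ have the same relative order as $\tau(1),\dots,\tau(k)$. A permuton is a probability measure on $[0,1]^2$ with both marginals uniform on $[0,1]$; for a permuton $\mu$, $t(\tau,\mu)$ is the probability that, when i.i.d. points $(X_1,Y_1),\dots,(X_k,Y_k)$ of law $\mu$ are listed in increasing order of their $X$-coordinates, their $Y$-coordinates have the same relative order as $\tau(1),\dots,\tau(k)$. **Theorem (law of large numbers for pattern densities).** 1. For every $g$ as above and every $y\in[0,1)$, the function $V_g(\cdot,y)$ takes values in $[0,1)$ on $[0,1)$ and solves there $V_g(0,y)=y$, $\partial_xV_g(x,y)=g(V_g(x,y))/g(x)$; and $\mu_g$ is a permuton whose joint distribution function is $x+y-V_g(x,y)$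 for $x,y\in[0,1]$. 2. If $\sigma_n\sim\mathrm{PERM}(g,n)$ for every $n\ge1$, then for every $k\in\mathbb N$ and every $\tau\in S_k$, $$t(\tau,\sigma_n)\to t(\tau,\mu_g)\quad\text{in probability as } n\to\infty.$$ 3. If $\tau\in S_2$ is the transposition, then $t(\tau,\mu_g)=2\int_0^1u(s)g(s)\,ds$. 4. For every $k\ge1$, if $\sigma_n$ is distributed according to the $k$-card-minimum model on $S_n$ for every $n\ge1$ and $\mathrm{inv}(\sigma_n)$ is its number of inversions, then $\mathrm{inv}(\sigma_n)/\binom n2\to\frac1{k+1}$ in probability as $n\to\infty$. -/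

import Mathlib

open MeasureTheory ProbabilityTheory Filter Topology Set

namespace GPermutation

/-! ### The card-picking procedure

Positions and cards are numbered from `0`: `Fin n` stands for `[n]`, the step `i : Fin n` is the
`(i+1)`-st step, and the value `c i : Fin (n - i)` means that the `(c i + 1)`-st lowest card of the
remaining deck is picked. -/

instance instMeasurableSpacePerm (n : ℕ) : MeasurableSpace (Equiv.Perm (Fin n)) := ⊤

/-- The set of cards remaining in the old deck after `i` steps, given the choices `c`; it has
`n - i` elements. -/
def deck {n : ℕ} (c : (i : Fin n) → Fin (n - i)) :
    (i : ℕ) → i ≤ n → {D : Finset (Fin n) // D.card = n - i}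
  | 0, _ => ⟨Finset.univ, by simp⟩
  | i + 1, h =>
    ⟨(deck c i (by omega)).1.erase
        ((deck c i (by omega)).1.orderEmbOfFin (deck c i (by omega)).2 (c ⟨i, h⟩)), by
      rw [Finset.card_erase_of_mem (Finset.orderEmbOfFin_mem _ _ _), (deck c i (by omega)).2]
      omega⟩

/-- The card picked in step `i`: the `c i`-th lowest of the remaining cards (counted from `0`). -/
def pickedCard {n : ℕ} (c : (i : Fin n) → Fin (n - i)) (i : Fin n) : Fin n :=
  (deck c i i.2.le).1.orderEmbOfFin (deck c i i.2.le).2 (c i)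

theorem deck_succ {n : ℕ} (c : (i : Fin n) → Fin (n - i)) (i : ℕ) (h : i + 1 ≤ n) :
    (deck c (i + 1) h).1 = (deck c i (by omega)).1.erase (pickedCard c ⟨i, h⟩) := rfl

theorem pickedCard_notMem_deck {n : ℕ} (c : (i : Fin n) → Fin (n - i)) (i : Fin n) (j : ℕ)
    (hj : j ≤ n) (hij : (i : ℕ) < j) : pickedCard c i ∉ (deck c j hj).1 := by
  induction j with
  | zero => omega
  | succ j ih =>
    rw [deck_succ]
    rcases Nat.lt_succ_iff_lt_or_eq.mp hij with h | h
    · exact fun hm => ih (by omega) h (Finset.mem_of_mem_erase hm)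
    · obtain rfl : i = ⟨j, hj⟩ := Fin.ext h
      exact Finset.notMem_erase _ _

theorem pickedCard_injective {n : ℕ} (c : (i : Fin n) → Fin (n - i)) :
    Function.Injective (pickedCard c) := by
  have key : ∀ i j : Fin n, i < j → pickedCard c i ≠ pickedCard c j := fun i j hij he =>
    pickedCard_notMem_deck c i j j.2.le hij (he ▸ Finset.orderEmbOfFin_mem _ _ _)
  intro i j he
  rcases lt_trichotomy i j with h | h | h
  · exact absurd he (key i j h)
  · exact h
  · exact absurd he.symm (key j i h)

/-- The permutation generated from the choices `c`. -/
noncomputable def pickedPerm {n : ℕ} (c : (i : Fin n) → Fin (n - i)) : Equiv.Perm (Fin n) :=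
  Equiv.ofBijective (pickedCard c) (Finite.injective_iff_bijective.mp (pickedCard_injective c))

/-- The law of the permutation generated by independent choices, the `i`-th having law `ν i`. -/
noncomputable def cardPickingLaw {n : ℕ} (ν : (i : Fin n) → Measure (Fin (n - i))) :
    Measure (Equiv.Perm (Fin n)) :=
  (Measure.pi ν).map pickedPerm

/-! ### The `g`-random permutation and the `k`-card-minimum model -/

/-- A strictly decreasing `C¹` function `g` on `[0,1]` with `g 0 = 1` and `g 1 = 0`. -/
structure Admissible (g : ℝ → ℝ) : Prop where
  contDiffOn : ContDiffOn ℝ 1 g (Icc 0 1)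
  strictAntiOn : StrictAntiOn g (Icc 0 1)
  map_zero : g 0 = 1
  map_one : g 1 = 0

/-- The distribution of the choice in step `i`, with mass
`(g ((i + l) / n) - g ((i + l + 1) / n)) / g (i / n)` at `l`. -/
noncomputable def choiceLaw (g : ℝ → ℝ) (n : ℕ) (i : Fin n) : Measure (Fin (n - i)) :=
  ∑ l : Fin (n - i), ENNReal.ofReal
    ((g (((i : ℝ) + (l : ℝ)) / n) - g (((i : ℝ) + (l : ℝ) + 1) / n)) / g ((i : ℝ) / n)) •
      Measure.dirac l

/-- The law `PERM(g, n)` of a `g`-random permutation. -/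
noncomputable def permLaw (g : ℝ → ℝ) (n : ℕ) : Measure (Equiv.Perm (Fin n)) :=
  cardPickingLaw (choiceLaw g n)

/-- The law of the minimum of `k` independent uniform elements of `Fin m`. -/
noncomputable def minUniformLaw (k : ℕ) (hk : 0 < k) (m : ℕ) : Measure (Fin m) :=
  (Measure.pi fun _ : Fin k => (uniformOn Set.univ : Measure (Fin m))).map
    fun x => Finset.univ.inf' ⟨⟨0, hk⟩, Finset.mem_univ _⟩ x

/-- The law of the permutation of `[n]` generated by the `k`-card-minimum model. -/
noncomputable def kCMLaw (k : ℕ) (hk : 0 < k) (n : ℕ) : Measure (Equiv.Perm (Fin n)) :=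
  cardPickingLaw fun i : Fin n => minUniformLaw k hk (n - i)

/-! ### Permutons, and the permuton arising from `g` -/

/-- A permuton, as a measure on `ℝ × ℝ`: both marginals are uniform on `[0,1]` (so that `μ` is
a probability measure carried by `[0,1]²`). -/
structure IsPermuton (μ : Measure (ℝ × ℝ)) : Prop where
  map_fst : μ.map Prod.fst = volume.restrict (Icc 0 1)
  map_snd : μ.map Prod.snd = volume.restrict (Icc 0 1)

/-- The joint cumulative distribution function. -/
noncomputable def jointCdf (μ : Measure (ℝ × ℝ)) (x y : ℝ) : ℝ := μ.real (Iic x ×ˢ Iic y)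

/-- `u(x) = ∫₀ˣ 1 / g(z) dz`. -/
noncomputable def uFun (g : ℝ → ℝ) (x : ℝ) : ℝ := ∫ z in (0 : ℝ)..x, 1 / g z

/-- `V_g(x,y) = u⁻¹(u(x) + u(y))` for `x, y ∈ [0,1)`, where `u⁻¹` is the inverse of
`u : [0,1) → [0,∞)`, and `V_g(x,y) = 1` if `x = 1` or `y = 1`. -/
noncomputable def cupCdf (g : ℝ → ℝ) (x y : ℝ) : ℝ :=
  open Classical in
  if x < 1 ∧ y < 1 then Function.invFunOn (uFun g) (Ico 0 1) (uFun g x + uFun g y) else 1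

/-- The density `f_g(x,y) = -g'(V_g(x,y)) g(V_g(x,y)) / (g(x) g(y))`. -/
noncomputable def density (g : ℝ → ℝ) (x y : ℝ) : ℝ :=
  -derivWithin g (Icc 0 1) (cupCdf g x y) * g (cupCdf g x y) / (g x * g y)

/-- The measure `μ_g` with density `f_g` on `[0,1)²`. -/
noncomputable def permuton (g : ℝ → ℝ) : Measure (ℝ × ℝ) :=
  ((volume : Measure (ℝ × ℝ)).restrict (Ico 0 1 ×ˢ Ico 0 1)).withDensity
    fun p => ENNReal.ofReal (density g p.1 p.2)

/-! ### Pattern densities and inversions -/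

/-- `t(τ,σ)`: the fraction of the `k`-tuples `i₁ < ⋯ < i_k` in `[n]` such that
`σ(i₁), …, σ(i_k)` are in the same relative order as `τ(1), …, τ(k)`. -/
noncomputable def patternDensity {k n : ℕ} (τ : Equiv.Perm (Fin k)) (σ : Equiv.Perm (Fin n)) : ℝ :=
  open Classical in
  ((Finset.univ.filter fun e : Fin k → Fin n =>
    StrictMono e ∧ ∀ a b, σ (e a) < σ (e b) ↔ τ a < τ b).card : ℝ) / (n.choose k : ℝ)

/-- `t(τ,μ)`: the probability that, for i.i.d. points `(X₁,Y₁), …, (X_k,Y_k)` of law `μ`, listing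
the points in increasing order of their `X`-coordinates puts the `Y`-coordinates in the same
relative order as `τ(1), …, τ(k)`. -/
noncomputable def permutonPatternDensity {k : ℕ} (τ : Equiv.Perm (Fin k))
    (μ : Measure (ℝ × ℝ)) : ℝ :=
  (Measure.pi fun _ : Fin k => μ).real
    {p | ∃ s : Equiv.Perm (Fin k), (∀ a b, a < b → (p (s a)).1 < (p (s b)).1) ∧
      ∀ a b, (p (s a)).2 < (p (s b)).2 ↔ τ a < τ b}

/-- The number of inversions of a permutation. -/
def inversions {n : ℕ} (σ : Equiv.Perm (Fin n)) : ℕ :=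
  (Finset.univ.filter fun p : Fin n × Fin n => p.1 < p.2 ∧ σ p.2 < σ p.1).card

/-- Convergence in probability to a constant of random variables `X n`, each on its own
probability space. -/
def ConvergesInProbability {Ω : ℕ → Type*} [∀ n, MeasurableSpace (Ω n)]
    (P : ∀ n, Measure (Ω n)) (X : ∀ n, Ω n → ℝ) (a : ℝ) : Prop :=
  ∀ ε : ℝ, 0 < ε → Tendsto (fun n => P n {ω | ε ≤ |X n ω - a|}) atTop (𝓝 0)

end GPermutation

open GPermutation

/-!
# Pattern densities of `g`-random permutations

Fix a level `m` and let `N` be the number of the first `i` picked cards that are among the `m`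
lowest. The remaining deck then contains `m - N` of these cards, so with `Z = i + m - N` the tail
formula for the choices says that, conditionally on the past, `Z` goes up by one in step `i` with
probability `g (Z / n) / g (i / n)` and stays put otherwise. This is the Euler scheme, with noise,
of the differential equation `∂ₓV = g(V) / g(x)` solved by `V_g`. As `g` is decreasing, each
step increases the mean square of `Z / n - V_g(i / n, y)` at most by the discretization error and
the contribution of the noise (`Admissible.meanSq_succ_le`). Summing over the steps gives
convergence of the joint distribution function of the empirical measure of the permutation to
`x + y - V_g(x,y)` (`Admissible.tendsto_integral_abs_countBelow`).

That `x + y - V_g(x,y)` is the joint distribution function of `μ_g` follows by two applications of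
the fundamental theorem of calculus: the density is the `y`-derivative of `-g(V_g(x,y)) / g(x)`,
and `g(V_g(x,y)) / g(x)` is the `x`-derivative of `V_g`. The first antiderivative is continuous
up to `y = 1`, where `V_g = 1`, and this gives the marginals as well
(`Admissible.isPermuton_permuton`, `Admissible.jointCdf_permuton`).

Pattern densities pass to the limit by quantization. Replacing the points by the cells of an
`(M + 1) × (M + 1)` grid changes a pattern probability only if two of the `k` points share a row or
a column, which has probability at most of the order of `k² / M` under a permuton; and the quantized
probability is a polynomial in finitely many cell masses, which are determined by the joint
distribution function (`IsPermuton.abs_permutonPatternDensity_sub_le`).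

For inversions, the upper left quadrant at `(x, y)` has `μ_g`-measure `V_g(x,y) - y`. Its mean under
`μ_g` is `∫ G / g` with `G(x) = ∫ₓ¹ g`, since `-(V_g g(V_g) + G(V_g)) / g(x)` is an antiderivative
of `V_g f_g` in `y`, and an integration by parts turns this into `∫ u g`
(`Admissible.permutonPatternDensity_swap`, `Admissible.integral_uFun_mul`). The card-minimum
model with parameter `k` is the case `g(x) = (1 - x)^k`, in which `G / g = (1 - x) / (k + 1)`.
-/

namespace GPermutation

/-! ### The function `u` and its inverse -/

namespace Admissible

variable {g : ℝ → ℝ}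

theorem continuousOn (hg : Admissible g) : ContinuousOn g (Icc 0 1) := hg.contDiffOn.continuousOn

theorem pos (hg : Admissible g) {x : ℝ} (hx : x ∈ Ico (0 : ℝ) 1) : 0 < g x := by
  rw [← hg.map_one]
  exact hg.strictAntiOn ⟨hx.1, hx.2.le⟩ (right_mem_Icc.2 zero_le_one) hx.2

theorem nonneg (hg : Admissible g) {x : ℝ} (hx : x ∈ Icc (0 : ℝ) 1) : 0 ≤ g x := by
  rw [← hg.map_one]
  exact hg.strictAntiOn.antitoneOn hx (right_mem_Icc.2 zero_le_one) hx.2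

theorem hasDerivWithinAt (hg : Admissible g) {x : ℝ} (hx : x ∈ Icc (0 : ℝ) 1) :
    HasDerivWithinAt g (derivWithin g (Icc 0 1) x) (Icc 0 1) x :=
  (hg.contDiffOn.differentiableOn one_ne_zero x hx).hasDerivWithinAt

theorem hasDerivAt (hg : Admissible g) {x : ℝ} (hx : x ∈ Ioo (0 : ℝ) 1) :
    HasDerivAt g (derivWithin g (Icc 0 1) x) x :=
  (hg.hasDerivWithinAt (Ioo_subset_Icc_self hx)).hasDerivAt (Icc_mem_nhds hx.1 hx.2)

theorem continuousOn_derivWithin (hg : Admissible g) :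
    ContinuousOn (derivWithin g (Icc 0 1)) (Icc 0 1) :=
  hg.contDiffOn.continuousOn_derivWithin (uniqueDiffOn_Icc zero_lt_one) le_rfl

theorem derivWithin_nonpos (hg : Admissible g) (x : ℝ) : derivWithin g (Icc 0 1) x ≤ 0 :=
  hg.strictAntiOn.antitoneOn.derivWithin_nonpos

/-- The function `g` vanishes at least linearly at `1`, because it is `C¹` up to the end point. -/
theorem exists_le_mul (hg : Admissible g) :
    ∃ C : ℝ, 0 < C ∧ ∀ x ∈ Icc (0 : ℝ) 1, g x ≤ C * (1 - x) := by
  obtain ⟨C, hC⟩ := (isCompact_Icc (a := (0 : ℝ)) (b := 1)).exists_bound_of_continuousOn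
    hg.continuousOn_derivWithin
  refine ⟨max C 1, by positivity, fun x hx => ?_⟩
  have h := Convex.norm_image_sub_le_of_norm_hasDerivWithin_le (s := Icc (0 : ℝ) 1)
    (fun y hy => hg.hasDerivWithinAt hy) (fun y hy => (hC y hy).trans (le_max_left C 1))
    (convex_Icc 0 1) hx (right_mem_Icc.2 zero_le_one)
  rw [hg.map_one, zero_sub, norm_neg, Real.norm_of_nonneg (hg.nonneg hx),
    Real.norm_of_nonneg (by linarith [hx.2])] at h
  exact h

end Admissible

/-- The extension of `g` from `[0,1]` to `ℝ` by its values at the end points. It makes `u` the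
restriction of a function that is differentiable at the left end point too. -/
noncomputable def clampExt (g : ℝ → ℝ) (x : ℝ) : ℝ := g (max 0 (min x 1))

/-- The extension of `u` to `(-∞,1)`, with `uExt g x = x` for `x ≤ 0` when `g 0 = 1`. -/
noncomputable def uExt (g : ℝ → ℝ) (x : ℝ) : ℝ := ∫ z in (0 : ℝ)..x, 1 / clampExt g z

/-- The inverse `ℝ → (-∞,1)` of `uExt g`. -/
noncomputable def uInv (g : ℝ → ℝ) (s : ℝ) : ℝ := Function.invFunOn (uExt g) (Iio 1) s

theorem clampExt_of_mem {g : ℝ → ℝ} {x : ℝ} (hx : x ∈ Icc (0 : ℝ) 1) : clampExt g x = g x := by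
  rw [clampExt, min_eq_left hx.2, max_eq_right hx.1]

theorem uExt_of_mem (g : ℝ → ℝ) {x : ℝ} (hx : x ∈ Icc (0 : ℝ) 1) : uExt g x = uFun g x := by
  refine intervalIntegral.integral_congr fun z hz => ?_
  rw [uIcc_of_le hx.1] at hz
  simp only [clampExt_of_mem ⟨hz.1, hz.2.trans hx.2⟩]

theorem uExt_zero (g : ℝ → ℝ) : uExt g 0 = 0 := by simp [uExt]

namespace Admissible

variable {g : ℝ → ℝ}

theorem continuous_clampExt (hg : Admissible g) : Continuous (clampExt g) :=
  hg.continuousOn.comp_continuous (by fun_prop)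
    fun x => ⟨le_max_left _ _, max_le zero_le_one (min_le_right _ _)⟩

theorem clampExt_pos (hg : Admissible g) {x : ℝ} (hx : x < 1) : 0 < clampExt g x :=
  hg.pos ⟨le_max_left _ _, max_lt zero_lt_one (min_lt_of_left_lt hx)⟩

theorem continuousOn_one_div_clampExt (hg : Admissible g) :
    ContinuousOn (fun z => 1 / clampExt g z) (Iio 1) :=
  continuousOn_const.div hg.continuous_clampExt.continuousOn fun _ hx => (hg.clampExt_pos hx).ne'

theorem hasDerivAt_uExt (hg : Admissible g) {x : ℝ} (hx : x < 1) :
    HasDerivAt (uExt g) (1 / clampExt g x) x := by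
  refine intervalIntegral.integral_hasDerivAt_right ?_ ?_ ?_
  · refine (hg.continuousOn_one_div_clampExt.mono fun z hz => ?_).intervalIntegrable
    exact lt_of_le_of_lt hz.2 (max_lt zero_lt_one hx)
  · exact hg.continuousOn_one_div_clampExt.stronglyMeasurableAtFilter isOpen_Iio x hx
  · exact hg.continuousOn_one_div_clampExt.continuousAt (Iio_mem_nhds hx)

theorem continuousOn_uExt (hg : Admissible g) : ContinuousOn (uExt g) (Iio 1) :=
  fun _ hx => (hg.hasDerivAt_uExt hx).continuousAt.continuousWithinAt

theorem strictMonoOn_uExt (hg : Admissible g) : StrictMonoOn (uExt g) (Iio 1) := by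
  refine strictMonoOn_of_deriv_pos (convex_Iio 1) hg.continuousOn_uExt fun x hx => ?_
  rw [interior_Iio] at hx
  rw [(hg.hasDerivAt_uExt hx).deriv]
  exact one_div_pos.2 (hg.clampExt_pos hx)

theorem uExt_of_nonpos (hg : Admissible g) {x : ℝ} (hx : x ≤ 0) : uExt g x = x := by
  have : ∫ z in (0 : ℝ)..x, 1 / clampExt g z = ∫ z in (0 : ℝ)..x, (1 : ℝ) := by
    refine intervalIntegral.integral_congr fun z hz => ?_
    rw [uIcc_of_ge hx] at hz
    simp [clampExt, hz.2, (hz.2.trans zero_le_one), hg.map_zero]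
  rw [uExt, this]
  simp

/-- Since `g x ≤ C (1 - x)`, the function `u` dominates `-log (1 - x) / C`. -/
theorem exists_neg_log_le (hg : Admissible g) :
    ∃ C : ℝ, 0 < C ∧ ∀ x ∈ Ico (0 : ℝ) 1, -Real.log (1 - x) / C ≤ uExt g x := by
  obtain ⟨C, hC, hle⟩ := hg.exists_le_mul
  refine ⟨C, hC, fun x hx => ?_⟩
  have hder : ∀ z ∈ Ico (0 : ℝ) 1, HasDerivAt (fun z => uExt g z + Real.log (1 - z) / C)
      (1 / clampExt g z + (-1) / (1 - z) / C) z := fun z hz =>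
    (hg.hasDerivAt_uExt hz.2).add
      ((((hasDerivAt_id z).const_sub 1).log (by simpa using (sub_pos.2 hz.2).ne')).div_const C)
  have hmono : MonotoneOn (fun z => uExt g z + Real.log (1 - z) / C) (Ico 0 1) := by
    refine monotoneOn_of_deriv_nonneg (convex_Ico 0 1)
      (fun z hz => (hder z hz).continuousAt.continuousWithinAt)
      (fun z hz => ((hder z (interior_subset hz)).differentiableAt).differentiableWithinAt)
      fun z hz => ?_
    have hz' := interior_subset hz
    rw [(hder z hz').deriv, clampExt_of_mem ⟨hz'.1, hz'.2.le⟩, div_div, neg_div, ← sub_eq_add_neg,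
      sub_nonneg, mul_comm]
    exact one_div_le_one_div_of_le (hg.pos hz') (hle z ⟨hz'.1, hz'.2.le⟩)
  have h := hmono (left_mem_Ico.2 zero_lt_one) hx hx.1
  simp only [uExt_zero, sub_zero, Real.log_one, zero_div, add_zero] at h
  rw [neg_div]
  linarith

theorem surjOn_uExt (hg : Admissible g) : SurjOn (uExt g) (Iio 1) univ := by
  intro s _
  rcases le_total s 0 with hs | hs
  · exact ⟨s, hs.trans_lt zero_lt_one, hg.uExt_of_nonpos hs⟩
  obtain ⟨C, hC, hlog⟩ := hg.exists_neg_log_le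
  have hx : 1 - Real.exp (-(C * s)) ∈ Ico (0 : ℝ) 1 :=
    ⟨sub_nonneg.2 (Real.exp_le_one_iff.2 (by nlinarith)), by linarith [Real.exp_pos (-(C * s))]⟩
  have h := hlog _ hx
  rw [sub_sub_cancel, Real.log_exp, neg_neg, mul_div_cancel_left₀ _ hC.ne'] at h
  obtain ⟨x, hx', rfl⟩ := intermediate_value_Icc hx.1
    (hg.continuousOn_uExt.mono fun z hz => hz.2.trans_lt hx.2)
    (show s ∈ Icc (uExt g 0) (uExt g _) from ⟨by rwa [uExt_zero], h⟩)
  exact ⟨x, hx'.2.trans_lt hx.2, rfl⟩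

theorem uInv_lt_one (hg : Admissible g) (s : ℝ) : uInv g s < 1 :=
  Function.invFunOn_mem (hg.surjOn_uExt (mem_univ s))

theorem uExt_uInv (hg : Admissible g) (s : ℝ) : uExt g (uInv g s) = s :=
  Function.invFunOn_eq (hg.surjOn_uExt (mem_univ s))

theorem uInv_uExt (hg : Admissible g) {x : ℝ} (hx : x < 1) : uInv g (uExt g x) = x :=
  hg.strictMonoOn_uExt.injOn (hg.uInv_lt_one _) hx (hg.uExt_uInv _)

theorem strictMono_uInv (hg : Admissible g) : StrictMono (uInv g) := by
  intro s t hst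
  rw [← hg.strictMonoOn_uExt.lt_iff_lt (hg.uInv_lt_one s) (hg.uInv_lt_one t),
    hg.uExt_uInv, hg.uExt_uInv]
  exact hst

theorem continuous_uInv (hg : Admissible g) : Continuous (uInv g) := by
  rw [continuous_iff_continuousAt]
  intro s
  refine continuousAt_of_monotoneOn_of_image_mem_nhds (s := univ)
    (hg.strictMono_uInv.monotone.monotoneOn _) univ_mem ?_
  refine mem_of_superset (Iio_mem_nhds (hg.uInv_lt_one s)) fun x hx => ?_
  exact ⟨uExt g x, mem_univ _, hg.uInv_uExt hx⟩

theorem hasDerivAt_uInv (hg : Admissible g) (s : ℝ) :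
    HasDerivAt (uInv g) (clampExt g (uInv g s)) s := by
  have h := (hg.hasDerivAt_uExt (hg.uInv_lt_one s)).of_local_left_inverse
    hg.continuous_uInv.continuousAt
    (one_div_pos.2 (hg.clampExt_pos (hg.uInv_lt_one s))).ne' (Eventually.of_forall hg.uExt_uInv)
  simpa using h

theorem uExt_nonneg (hg : Admissible g) {x : ℝ} (hx : x ∈ Ico (0 : ℝ) 1) : 0 ≤ uExt g x := by
  have := hg.strictMonoOn_uExt.monotoneOn
    (show (0 : ℝ) ∈ Iio 1 from mem_Iio.2 zero_lt_one) hx.2 hx.1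
  rwa [uExt_zero] at this

theorem uInv_mem (hg : Admissible g) {s : ℝ} (hs : 0 ≤ s) : uInv g s ∈ Ico (0 : ℝ) 1 := by
  refine ⟨?_, hg.uInv_lt_one s⟩
  have := hg.strictMono_uInv.monotone hs
  rwa [← uExt_zero g, hg.uInv_uExt zero_lt_one] at this

/-! ### The function `V_g` -/

theorem cupCdf_eq (hg : Admissible g) {x y : ℝ} (hx : x ∈ Ico (0 : ℝ) 1) (hy : y ∈ Ico (0 : ℝ) 1) :
    cupCdf g x y = uInv g (uExt g x + uExt g y) := by
  rw [cupCdf, if_pos ⟨hx.2, hy.2⟩, ← uExt_of_mem g ⟨hx.1, hx.2.le⟩,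
    ← uExt_of_mem g ⟨hy.1, hy.2.le⟩]
  have hmem := hg.uInv_mem (add_nonneg (hg.uExt_nonneg hx) (hg.uExt_nonneg hy))
  set s := uExt g x + uExt g y
  have hs : s ∈ uFun g '' Ico 0 1 :=
    ⟨_, hmem, by rw [← uExt_of_mem g ⟨hmem.1, hmem.2.le⟩, hg.uExt_uInv]⟩
  have h1 := Function.invFunOn_mem hs
  have h2 := Function.invFunOn_eq hs
  rw [← uExt_of_mem g ⟨h1.1, h1.2.le⟩] at h2
  conv_rhs => rw [← h2]
  rw [hg.uInv_uExt h1.2]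

theorem cupCdf_mem (hg : Admissible g) {x y : ℝ} (hx : x ∈ Ico (0 : ℝ) 1)
    (hy : y ∈ Ico (0 : ℝ) 1) : cupCdf g x y ∈ Ico (0 : ℝ) 1 := by
  rw [hg.cupCdf_eq hx hy]
  exact hg.uInv_mem (add_nonneg (hg.uExt_nonneg hx) (hg.uExt_nonneg hy))

end Admissible

theorem cupCdf_comm (g : ℝ → ℝ) (x y : ℝ) : cupCdf g x y = cupCdf g y x := by
  simp only [cupCdf, and_comm, add_comm]

theorem density_comm (g : ℝ → ℝ) (x y : ℝ) : density g x y = density g y x := by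
  rw [density, density, cupCdf_comm, mul_comm (g x)]

theorem cupCdf_one_right (g : ℝ → ℝ) (x : ℝ) : cupCdf g x 1 = 1 := by simp [cupCdf]

theorem cupCdf_one_left (g : ℝ → ℝ) (y : ℝ) : cupCdf g 1 y = 1 := by simp [cupCdf]

namespace Admissible

variable {g : ℝ → ℝ}

theorem cupCdf_mem_Icc (hg : Admissible g) {x y : ℝ} (hx : x ∈ Icc (0 : ℝ) 1)
    (hy : y ∈ Icc (0 : ℝ) 1) : cupCdf g x y ∈ Icc (0 : ℝ) 1 := by
  rcases hx.2.lt_or_eq with hx1 | rfl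
  · rcases hy.2.lt_or_eq with hy1 | rfl
    · exact Ico_subset_Icc_self (hg.cupCdf_mem ⟨hx.1, hx1⟩ ⟨hy.1, hy1⟩)
    · simp [cupCdf_one_right]
  · simp [cupCdf_one_left]

theorem cupCdf_zero_left (hg : Admissible g) {y : ℝ} (hy : y ∈ Ico (0 : ℝ) 1) :
    cupCdf g 0 y = y := by
  rw [hg.cupCdf_eq (left_mem_Ico.2 zero_lt_one) hy, uExt_zero, zero_add, hg.uInv_uExt hy.2]

theorem cupCdf_zero_right (hg : Admissible g) {x : ℝ} (hx : x ∈ Ico (0 : ℝ) 1) :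
    cupCdf g x 0 = x := by rw [cupCdf_comm, hg.cupCdf_zero_left hx]

theorem le_cupCdf_right (hg : Admissible g) {x y : ℝ} (hx : x ∈ Ico (0 : ℝ) 1)
    (hy : y ∈ Ico (0 : ℝ) 1) : y ≤ cupCdf g x y := by
  rw [hg.cupCdf_eq hx hy]
  conv_lhs => rw [← hg.uInv_uExt hy.2]
  exact hg.strictMono_uInv.monotone (by linarith [hg.uExt_nonneg hx])

theorem le_cupCdf_left (hg : Admissible g) {x y : ℝ} (hx : x ∈ Ico (0 : ℝ) 1)
    (hy : y ∈ Ico (0 : ℝ) 1) : x ≤ cupCdf g x y := by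
  rw [cupCdf_comm]; exact hg.le_cupCdf_right hy hx

theorem hasDerivWithinAt_cupCdf_left (hg : Admissible g) {x y : ℝ} (hx : x ∈ Ico (0 : ℝ) 1)
    (hy : y ∈ Ico (0 : ℝ) 1) :
    HasDerivWithinAt (fun x' => cupCdf g x' y) (g (cupCdf g x y) / g x) (Ico 0 1) x := by
  have h := (hg.hasDerivAt_uInv (uExt g x + uExt g y)).comp x
    ((hg.hasDerivAt_uExt hx.2).add_const (uExt g y))
  have hV := hg.cupCdf_mem hx hy
  rw [← hg.cupCdf_eq hx hy, clampExt_of_mem ⟨hV.1, hV.2.le⟩, clampExt_of_mem ⟨hx.1, hx.2.le⟩,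
    mul_one_div] at h
  exact h.hasDerivWithinAt.congr (fun z hz => hg.cupCdf_eq hz hy) (hg.cupCdf_eq hx hy)

theorem hasDerivAt_cupCdf_left (hg : Admissible g) {x y : ℝ} (hx : x ∈ Ioo (0 : ℝ) 1)
    (hy : y ∈ Ico (0 : ℝ) 1) :
    HasDerivAt (fun x' => cupCdf g x' y) (g (cupCdf g x y) / g x) x :=
  (hg.hasDerivWithinAt_cupCdf_left (Ioo_subset_Ico_self hx) hy).hasDerivAt
    (Ico_mem_nhds hx.1 hx.2)

theorem hasDerivAt_cupCdf_right (hg : Admissible g) {x y : ℝ} (hx : x ∈ Ico (0 : ℝ) 1)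
    (hy : y ∈ Ioo (0 : ℝ) 1) :
    HasDerivAt (cupCdf g x) (g (cupCdf g x y) / g y) y := by
  have h := hg.hasDerivAt_cupCdf_left hy hx
  simp only [cupCdf_comm g _ x] at h
  exact h

theorem continuousOn_cupCdf_uncurry (hg : Admissible g) :
    ContinuousOn (fun p : ℝ × ℝ => cupCdf g p.1 p.2) (Ico 0 1 ×ˢ Ico 0 1) := by
  have hu : ContinuousOn (uExt g) (Ico 0 1) := hg.continuousOn_uExt.mono fun z hz => hz.2
  have : ContinuousOn (fun p : ℝ × ℝ => uInv g (uExt g p.1 + uExt g p.2)) (Ico 0 1 ×ˢ Ico 0 1) :=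
    hg.continuous_uInv.comp_continuousOn
      ((hu.comp continuousOn_fst fun p hp => hp.1).add
        (hu.comp continuousOn_snd fun p hp => hp.2))
  exact this.congr fun p hp => hg.cupCdf_eq hp.1 hp.2

/-- The function `V_g(x, ·)` is continuous on the closed interval, where it reaches the value `1`
at `1`; this is what allows integrals up to `1` to be evaluated without a limit argument. -/
theorem continuousOn_cupCdf_right (hg : Admissible g) {x : ℝ} (hx : x ∈ Ico (0 : ℝ) 1) :
    ContinuousOn (cupCdf g x) (Icc 0 1) := by
  intro y hy
  rcases hy.2.lt_or_eq with hy1 | rfl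
  · have h : ContinuousOn (cupCdf g x) (Ico 0 1) :=
      hg.continuousOn_cupCdf_uncurry.comp (f := fun y : ℝ => (x, y)) (by fun_prop)
        fun z hz => ⟨hx, hz⟩
    refine (h y ⟨hy.1, hy1⟩).mono_of_mem_nhdsWithin ?_
    filter_upwards [self_mem_nhdsWithin,
      mem_nhdsWithin_of_mem_nhds (Iio_mem_nhds hy1)] with z hz hz1
    exact ⟨hz.1, hz1⟩
  · rw [ContinuousWithinAt, cupCdf_one_right]
    refine tendsto_of_tendsto_of_tendsto_of_le_of_le' (g := id) (h := fun _ => 1)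
      (tendsto_id.mono_left nhdsWithin_le_nhds) tendsto_const_nhds ?_ ?_
    · filter_upwards [self_mem_nhdsWithin] with z hz
      rcases hz.2.lt_or_eq with hz1 | rfl
      · exact hg.le_cupCdf_right hx ⟨hz.1, hz1⟩
      · simp [cupCdf_one_right]
    · filter_upwards [self_mem_nhdsWithin] with z hz
      exact (hg.cupCdf_mem_Icc ⟨hx.1, hx.2.le⟩ hz).2

theorem continuousOn_cupCdf_left (hg : Admissible g) {y : ℝ} (hy : y ∈ Ico (0 : ℝ) 1) :
    ContinuousOn (fun x => cupCdf g x y) (Icc 0 1) :=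
  (hg.continuousOn_cupCdf_right hy).congr fun x _ => cupCdf_comm g x y

/-- The slope `∂ₓV_g` lies in `[0,1]`, because `V_g(x,y) ≥ x` and `g` is decreasing. -/
theorem slope_mem (hg : Admissible g) {x y : ℝ} (hx : x ∈ Ico (0 : ℝ) 1)
    (hy : y ∈ Icc (0 : ℝ) 1) : g (cupCdf g x y) / g x ∈ Icc (0 : ℝ) 1 := by
  have hV := hg.cupCdf_mem_Icc ⟨hx.1, hx.2.le⟩ hy
  refine ⟨div_nonneg (hg.nonneg hV) (hg.pos hx).le, div_le_one_of_le₀ ?_ (hg.pos hx).le⟩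
  refine hg.strictAntiOn.antitoneOn ⟨hx.1, hx.2.le⟩ hV ?_
  rcases hy.2.lt_or_eq with hy1 | rfl
  · exact hg.le_cupCdf_left hx ⟨hy.1, hy1⟩
  · rw [cupCdf_one_right]; exact hx.2.le

end Admissible

/-! ### The permuton `μ_g` -/

/-- The fundamental theorem of calculus for a nonnegative derivative, as a Lebesgue integral; the
derivative is needed in the open interval only and may be unbounded. -/
theorem setLIntegral_Ico_ofReal_deriv {a b : ℝ} (hab : a ≤ b) {H h : ℝ → ℝ}
    (hcont : ContinuousOn H (Icc a b)) (hderiv : ∀ x ∈ Ioo a b, HasDerivAt H (h x) x)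
    (hnonneg : ∀ x ∈ Ioo a b, 0 ≤ h x) :
    ∫⁻ t in Ico a b, ENNReal.ofReal (h t) = ENNReal.ofReal (H b - H a) := by
  have hint := intervalIntegral.integrableOn_deriv_of_nonneg hcont hderiv hnonneg
  rw [← intervalIntegral.integral_eq_sub_of_hasDerivAt_of_le hab hcont hderiv
      ((intervalIntegrable_iff_integrableOn_Ioc_of_le hab).2 hint),
    intervalIntegral.integral_of_le hab, ofReal_integral_eq_lintegral_ofReal hint,
    Measure.restrict_congr_set Ico_ae_eq_Ioc]
  rw [Measure.restrict_congr_set Ioo_ae_eq_Ioc.symm]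
  exact (ae_restrict_mem measurableSet_Ioo).mono hnonneg

theorem Iic_inter_Ico_ae_eq {y : ℝ} (hy : y ≤ 1) :
    (Iic y ∩ Ico 0 1 : Set ℝ) =ᵐ[volume] Ico 0 y := by
  rcases hy.lt_or_eq with hy1 | rfl
  · have : (Iic y ∩ Ico 0 1 : Set ℝ) = Icc 0 y := by
      ext z
      simp only [mem_inter_iff, mem_Iic, mem_Ico, mem_Icc]
      exact ⟨fun h => ⟨h.2.1, h.1⟩, fun h => ⟨h.2, h.1, h.2.trans_lt hy1⟩⟩
    rw [this]
    exact Ico_ae_eq_Icc.symm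
  · rw [inter_eq_right.2 fun z hz => hz.2.le]; rfl

namespace Admissible

variable {g : ℝ → ℝ}

theorem density_nonneg (hg : Admissible g) {x y : ℝ} (hx : x ∈ Ico (0 : ℝ) 1)
    (hy : y ∈ Ico (0 : ℝ) 1) : 0 ≤ density g x y :=
  div_nonneg (mul_nonneg (neg_nonneg.2 (hg.derivWithin_nonpos _)) (hg.pos (hg.cupCdf_mem hx hy)).le)
    (mul_nonneg (hg.pos hx).le (hg.pos hy).le)

theorem continuousOn_density (hg : Admissible g) :
    ContinuousOn (fun p : ℝ × ℝ => density g p.1 p.2) (Ico 0 1 ×ˢ Ico 0 1) := by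
  have hV := hg.continuousOn_cupCdf_uncurry
  have hmaps : MapsTo (fun p : ℝ × ℝ => cupCdf g p.1 p.2) (Ico 0 1 ×ˢ Ico 0 1) (Icc 0 1) :=
    fun p hp => Ico_subset_Icc_self (hg.cupCdf_mem hp.1 hp.2)
  have hgc : ContinuousOn g (Ico 0 1) := hg.continuousOn.mono Ico_subset_Icc_self
  refine (((hg.continuousOn_derivWithin.comp hV hmaps).neg).mul
    (hg.continuousOn.comp hV hmaps)).div
    ((hgc.comp continuousOn_fst fun p hp => hp.1).mul
      (hgc.comp continuousOn_snd fun p hp => hp.2)) fun p hp => ?_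
  exact mul_ne_zero (hg.pos hp.1).ne' (hg.pos hp.2).ne'

theorem aemeasurable_density (hg : Admissible g) :
    AEMeasurable (fun p : ℝ × ℝ => ENNReal.ofReal (density g p.1 p.2))
      ((volume : Measure (ℝ × ℝ)).restrict (Ico 0 1 ×ˢ Ico 0 1)) :=
  (hg.continuousOn_density.aemeasurable (measurableSet_Ico.prod measurableSet_Ico)).ennreal_ofReal

theorem permuton_prod (hg : Admissible g) {A B : Set ℝ} (hA : MeasurableSet A)
    (hB : MeasurableSet B) :
    permuton g (A ×ˢ B) =
      ∫⁻ s in A ∩ Ico 0 1, ∫⁻ t in B ∩ Ico 0 1, ENNReal.ofReal (density g s t) := by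
  have hsub : (A ∩ Ico (0 : ℝ) 1) ×ˢ (B ∩ Ico (0 : ℝ) 1) ⊆ Ico 0 1 ×ˢ Ico 0 1 :=
    prod_mono inter_subset_right inter_subset_right
  have hm := hg.aemeasurable_density.mono_measure (Measure.restrict_mono hsub le_rfl)
  rw [Measure.volume_eq_prod, ← Measure.prod_restrict] at hm
  rw [permuton, withDensity_apply _ (hA.prod hB), Measure.restrict_restrict (hA.prod hB),
    prod_inter_prod, Measure.volume_eq_prod, ← Measure.prod_restrict, lintegral_prod _ hm]

/-- Integrating the density in the second variable up to `y`: it is the derivative of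
`-g(V_g(s, ·)) / g(s)`. -/
theorem setLIntegral_density (hg : Admissible g) {s y : ℝ} (hs : s ∈ Ico (0 : ℝ) 1)
    (hy : y ∈ Icc (0 : ℝ) 1) :
    ∫⁻ t in Ico 0 y, ENNReal.ofReal (density g s t) =
      ENNReal.ofReal (1 - g (cupCdf g s y) / g s) := by
  have hsub : Icc (0 : ℝ) y ⊆ Icc 0 1 := Icc_subset_Icc_right hy.2
  have hpos := hg.pos hs
  rw [setLIntegral_Ico_ofReal_deriv (H := fun t => -g (cupCdf g s t) / g s) hy.1]
  · rw [hg.cupCdf_zero_right hs, neg_div, neg_div, div_self hpos.ne']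
    congr 1
    ring
  · refine ((hg.continuousOn.comp ((hg.continuousOn_cupCdf_right hs).mono hsub) fun t ht => ?_).neg
      ).div_const _
    exact hg.cupCdf_mem_Icc (Ico_subset_Icc_self hs) (hsub ht)
  · intro t ht
    have ht1 : t ∈ Ioo (0 : ℝ) 1 := ⟨ht.1, ht.2.trans_le hy.2⟩
    have hV : cupCdf g s t ∈ Ioo (0 : ℝ) 1 :=
      ⟨ht.1.trans_le (hg.le_cupCdf_right hs (Ioo_subset_Ico_self ht1)),
        (hg.cupCdf_mem hs (Ioo_subset_Ico_self ht1)).2⟩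
    have h := (((hg.hasDerivAt hV).comp t (hg.hasDerivAt_cupCdf_right hs ht1)).neg).div_const (g s)
    refine h.congr_deriv ?_
    have := (hg.pos (Ioo_subset_Ico_self ht1)).ne'
    rw [density]
    field_simp
  · exact fun t ht => hg.density_nonneg hs ⟨ht.1.le, ht.2.trans_le hy.2⟩

/-- The measure of a product set whose second factor is, up to a null set, an initial segment of
`[0,1)`. -/
theorem permuton_prod_of_ae_eq (hg : Admissible g) {A B : Set ℝ} (hA : MeasurableSet A)
    (hB : MeasurableSet B) {y : ℝ} (hy : y ∈ Icc (0 : ℝ) 1)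
    (hBy : (B ∩ Ico 0 1 : Set ℝ) =ᵐ[volume] Ico 0 y) :
    permuton g (A ×ˢ B) = ∫⁻ s in A ∩ Ico 0 1, ENNReal.ofReal (1 - g (cupCdf g s y) / g s) := by
  rw [hg.permuton_prod hA hB]
  refine setLIntegral_congr_fun (hA.inter measurableSet_Ico) fun s hs => ?_
  rw [Measure.restrict_congr_set hBy, hg.setLIntegral_density hs.2 hy]

theorem permuton_prod_univ (hg : Admissible g) {A : Set ℝ} (hA : MeasurableSet A) :
    permuton g (A ×ˢ univ) = volume (A ∩ Ico 0 1) := by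
  rw [hg.permuton_prod_of_ae_eq hA MeasurableSet.univ (right_mem_Icc.2 zero_le_one)
    (by rw [univ_inter]; rfl)]
  simp [cupCdf_one_right, hg.map_one]

theorem permuton_prod_comm (hg : Admissible g) {A B : Set ℝ} (hA : MeasurableSet A)
    (hB : MeasurableSet B) : permuton g (A ×ˢ B) = permuton g (B ×ˢ A) := by
  have hsub : (A ∩ Ico (0 : ℝ) 1) ×ˢ (B ∩ Ico (0 : ℝ) 1) ⊆ Ico 0 1 ×ˢ Ico 0 1 :=
    prod_mono inter_subset_right inter_subset_right
  have hm := hg.aemeasurable_density.mono_measure (Measure.restrict_mono hsub le_rfl)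
  rw [Measure.volume_eq_prod, ← Measure.prod_restrict] at hm
  rw [hg.permuton_prod hA hB, hg.permuton_prod hB hA, lintegral_lintegral_swap hm]
  simp only [density_comm]

theorem isPermuton_permuton (hg : Admissible g) : IsPermuton (permuton g) where
  map_fst := by
    ext A hA
    rw [Measure.map_apply measurable_fst hA, ← prod_univ, hg.permuton_prod_univ hA,
      ← Measure.restrict_congr_set Ico_ae_eq_Icc, Measure.restrict_apply hA]
  map_snd := by
    ext A hA
    rw [Measure.map_apply measurable_snd hA, ← univ_prod,
      hg.permuton_prod_comm MeasurableSet.univ hA, hg.permuton_prod_univ hA,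
      ← Measure.restrict_congr_set Ico_ae_eq_Icc, Measure.restrict_apply hA]

theorem jointCdf_permuton (hg : Admissible g) {x y : ℝ} (hx : x ∈ Icc (0 : ℝ) 1)
    (hy : y ∈ Icc (0 : ℝ) 1) : jointCdf (permuton g) x y = x + y - cupCdf g x y := by
  rw [jointCdf, measureReal_def, hg.permuton_prod_of_ae_eq measurableSet_Iic measurableSet_Iic hy
    (Iic_inter_Ico_ae_eq hy.2), Measure.restrict_congr_set (Iic_inter_Ico_ae_eq hx.2)]
  rcases hy.2.lt_or_eq with hy1 | rfl
  · rw [setLIntegral_Ico_ofReal_deriv (H := fun s => s - cupCdf g s y) hx.1]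
    · rw [hg.cupCdf_zero_left ⟨hy.1, hy1⟩, ENNReal.toReal_ofReal]
      · ring
      have h : ∀ s ∈ Ioo (0 : ℝ) 1, HasDerivAt (fun s => s - cupCdf g s y)
          (1 - g (cupCdf g s y) / g s) s := fun s hs =>
        (hasDerivAt_id s).sub (hg.hasDerivAt_cupCdf_left hs ⟨hy.1, hy1⟩)
      have hm : MonotoneOn (fun s => s - cupCdf g s y) (Icc 0 1) := by
        refine monotoneOn_of_deriv_nonneg (convex_Icc 0 1)
          (continuousOn_id.sub (hg.continuousOn_cupCdf_left ⟨hy.1, hy1⟩)) ?_ ?_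
        all_goals rw [interior_Icc]
        · exact fun s hs => (h s hs).differentiableAt.differentiableWithinAt
        · intro s hs
          rw [(h s hs).deriv]
          linarith [(hg.slope_mem (Ioo_subset_Ico_self hs) hy).2]
      have := hm (left_mem_Icc.2 zero_le_one) hx hx.1
      simp only [hg.cupCdf_zero_left ⟨hy.1, hy1⟩] at this
      linarith
    · exact (continuousOn_id.sub (hg.continuousOn_cupCdf_left ⟨hy.1, hy1⟩)).mono
        (Icc_subset_Icc_right hx.2)
    · exact fun s hs => (hasDerivAt_id s).sub
        (hg.hasDerivAt_cupCdf_left ⟨hs.1, hs.2.trans_le hx.2⟩ ⟨hy.1, hy1⟩)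
    · intro s hs
      linarith [(hg.slope_mem ⟨hs.1.le, hs.2.trans_le hx.2⟩ hy).2]
  · simp [cupCdf_one_right, hg.map_one, hx.1]

end Admissible

theorem IsPermuton.isProbabilityMeasure {μ : Measure (ℝ × ℝ)} (h : IsPermuton μ) :
    IsProbabilityMeasure μ := by
  constructor
  have := congrArg (fun ν => ν univ) h.map_fst
  simpa [Measure.map_apply measurable_fst MeasurableSet.univ] using this

/-! ### The counting process of the card-picking procedure -/

/-- Resampling one coordinate of a finite product of probability spaces does not change
expectations. -/
theorem integral_pi_update {ι : Type*} [Fintype ι] [DecidableEq ι] {α : ι → Type*}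
    [∀ i, Fintype (α i)] [∀ i, MeasurableSpace (α i)] [∀ i, MeasurableSingletonClass (α i)]
    (ν : ∀ i, Measure (α i)) [∀ i, IsProbabilityMeasure (ν i)] (i : ι) (f : (∀ i, α i) → ℝ) :
    ∫ c, f c ∂Measure.pi ν = ∫ c, ∫ x, f (Function.update c i x) ∂ν i ∂Measure.pi ν := by
  obtain ⟨W, hW⟩ : ∃ W : (∀ i, α i) → ℝ, ∀ c, W c = ∏ j, (ν j).real {c j} := ⟨_, fun _ => rfl⟩
  have hw : ∀ c : ∀ i, α i, (Measure.pi ν).real {c} = W c := fun c => by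
    simp only [hW, measureReal_def, Measure.pi_singleton, ENNReal.toReal_prod]
  have hsum : ∑ x, (ν i).real {x} = 1 := by
    simp
  have hswap : ∀ (c : ∀ i, α i) (x : α i),
      W c * (ν i).real {x} = W (Function.update c i x) * (ν i).real {c i} := by
    intro c x
    simp only [hW]
    rw [← Finset.mul_prod_erase _ _ (Finset.mem_univ i),
      ← Finset.mul_prod_erase Finset.univ (fun j => (ν j).real {Function.update c i x j})
        (Finset.mem_univ i), Function.update_self]
    have : ∏ j ∈ Finset.univ.erase i, (ν j).real {Function.update c i x j} =
        ∏ j ∈ Finset.univ.erase i, (ν j).real {c j} :=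
      Finset.prod_congr rfl fun j hj => by
        rw [Function.update_of_ne (Finset.ne_of_mem_erase hj)]
    rw [this]
    ring
  -- exchanging the resampled value with the old one
  let e : ((∀ i, α i) × α i) ≃ ((∀ i, α i) × α i) :=
    { toFun := fun p => (Function.update p.1 i p.2, p.1 i)
      invFun := fun p => (Function.update p.1 i p.2, p.1 i)
      left_inv := fun p => by simp
      right_inv := fun p => by simp }
  rw [integral_fintype Integrable.of_finite, integral_fintype Integrable.of_finite]
  simp only [hw, integral_fintype Integrable.of_finite, smul_eq_mul]
  calc ∑ c, W c * f c = ∑ c, ∑ x, W c * (ν i).real {x} * f c := by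
        refine Finset.sum_congr rfl fun c _ => ?_
        rw [← Finset.sum_mul, ← Finset.mul_sum, hsum, mul_one]
    _ = ∑ p : (∀ i, α i) × α i, W p.1 * (ν i).real {p.2} * f p.1 :=
        (Fintype.sum_prod_type fun p : (∀ i, α i) × α i => W p.1 * (ν i).real {p.2} * f p.1).symm
    _ = ∑ p : (∀ i, α i) × α i, W (e p).1 * (ν i).real {(e p).2} * f (e p).1 :=
        (Equiv.sum_comp e fun p => W p.1 * (ν i).real {p.2} * f p.1).symm
    _ = ∑ p : (∀ i, α i) × α i,
          W p.1 * (ν i).real {p.2} * f (Function.update p.1 i p.2) :=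
        Finset.sum_congr rfl fun p _ => by rw [hswap p.1 p.2]; rfl
    _ = ∑ c, W c * ∑ x, (ν i).real {x} * f (Function.update c i x) := by
        rw [Fintype.sum_prod_type fun p : (∀ i, α i) × α i =>
          W p.1 * (ν i).real {p.2} * f (Function.update p.1 i p.2)]
        simp only [Finset.mul_sum, mul_assoc]

section Deck

variable {n : ℕ}

theorem deck_update (c : (i : Fin n) → Fin (n - i)) (i : Fin n) (x : Fin (n - i)) (j : ℕ)
    (hj : j ≤ n) (hji : j ≤ i) : deck (Function.update c i x) j hj = deck c j hj := by
  induction j with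
  | zero => rfl
  | succ j ih =>
    have hne : (⟨j, hj⟩ : Fin n) ≠ i := fun h => by
      have := congrArg Fin.val h
      simp only at this
      omega
    have h := ih (by omega) (by omega)
    apply Subtype.ext
    simp only [deck]
    rw [Function.update_of_ne hne]
    simp only [h]

theorem pickedCard_update_of_lt (c : (i : Fin n) → Fin (n - i)) (i : Fin n) (x : Fin (n - i))
    {j : Fin n} (hji : j < i) : pickedCard (Function.update c i x) j = pickedCard c j := by
  have h := deck_update c i x j j.2.le (Fin.le_def.1 hji.le)
  rw [pickedCard, pickedCard, Function.update_of_ne hji.ne]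
  simp only [h]

/-- The number of the first `i` positions whose card is among the `m` lowest ones. -/
def countBelow (σ : Equiv.Perm (Fin n)) (i m : ℕ) : ℕ :=
  (Finset.univ.filter fun j : Fin n => (j : ℕ) < i ∧ (σ j : ℕ) < m).card

theorem countBelow_zero (σ : Equiv.Perm (Fin n)) (m : ℕ) : countBelow σ 0 m = 0 := by
  simp [countBelow]

theorem countBelow_succ (σ : Equiv.Perm (Fin n)) (i : Fin n) (m : ℕ) :
    countBelow σ (i + 1) m = countBelow σ i m + if (σ i : ℕ) < m then 1 else 0 := by
  have h : (Finset.univ.filter fun j : Fin n => (j : ℕ) < i + 1 ∧ (σ j : ℕ) < m) =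
      (Finset.univ.filter fun j : Fin n => (j : ℕ) < i ∧ (σ j : ℕ) < m) ∪
        (Finset.univ.filter fun j : Fin n => j = i ∧ (σ j : ℕ) < m) := by
    ext j
    simp only [Finset.mem_filter, Finset.mem_univ, true_and, Finset.mem_union, Fin.ext_iff]
    omega
  have hd : Disjoint (Finset.univ.filter fun j : Fin n => (j : ℕ) < i ∧ (σ j : ℕ) < m)
      (Finset.univ.filter fun j : Fin n => j = i ∧ (σ j : ℕ) < m) := by
    rw [Finset.disjoint_filter]
    rintro j _ ⟨h1, _⟩ ⟨rfl, _⟩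
    exact h1.false
  rw [countBelow, h, Finset.card_union_of_disjoint hd, countBelow]
  congr 1
  rw [Finset.filter_and, Finset.filter_eq' _ i, if_pos (Finset.mem_univ i)]
  by_cases hm : (σ i : ℕ) < m
  · rw [if_pos hm, Finset.card_eq_one]
    refine ⟨i, ?_⟩
    ext j
    simp only [Finset.mem_inter, Finset.mem_singleton, Finset.mem_filter, Finset.mem_univ,
      true_and]
    exact ⟨fun h => h.1, fun h => ⟨h, h ▸ hm⟩⟩
  · rw [if_neg hm, Finset.card_eq_zero]
    ext j
    simp only [Finset.mem_inter, Finset.mem_singleton, Finset.mem_filter, Finset.mem_univ,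
      true_and, Finset.notMem_empty, iff_false, not_and]
    rintro rfl
    exact hm

theorem card_filter_val_lt {m : ℕ} (hm : m ≤ n) :
    (Finset.univ.filter fun j : Fin n => (j : ℕ) < m).card = m := by
  rw [Fin.card_filter_val_lt, min_eq_right hm]

theorem countBelow_full (σ : Equiv.Perm (Fin n)) {m : ℕ} (hm : m ≤ n) :
    countBelow σ n m = m := by
  conv_rhs => rw [← card_filter_val_lt hm]
  rw [countBelow]
  refine Finset.card_bij (fun j _ => σ j) (fun j hj => ?_) (fun a _ b _ h => σ.injective h)
    fun b hb => ⟨σ.symm b, ?_, σ.apply_symm_apply b⟩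
  · simpa using (Finset.mem_filter.1 hj).2.2
  · simpa using hb

theorem countBelow_all (σ : Equiv.Perm (Fin n)) {i : ℕ} (hi : i ≤ n) :
    countBelow σ i n = i := by
  conv_rhs => rw [← card_filter_val_lt hi]
  rw [countBelow]
  congr 1
  ext j
  simp

theorem countBelow_update (c : (i : Fin n) → Fin (n - i)) (i : Fin n) (x : Fin (n - i)) (m : ℕ) :
    countBelow (pickedPerm (Function.update c i x)) i m = countBelow (pickedPerm c) i m := by
  rw [countBelow, countBelow]
  congr 1
  refine Finset.filter_congr fun j _ => and_congr_right fun hj => ?_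
  change (pickedCard (Function.update c i x) j : ℕ) < m ↔ (pickedCard c j : ℕ) < m
  rw [pickedCard_update_of_lt c i x (Fin.lt_def.2 hj)]

/-- The elements of `D` below `m` are the first ones in the increasing enumeration of `D`. -/
theorem orderEmbOfFin_lt_iff {N : ℕ} (D : Finset (Fin n)) (hD : D.card = N) (l : Fin N) (m : ℕ) :
    (D.orderEmbOfFin hD l : ℕ) < m ↔ (l : ℕ) < (D.filter fun a : Fin n => (a : ℕ) < m).card := by
  have hcard : (D.filter fun a : Fin n => (a : ℕ) < m).card =
      (Finset.univ.filter fun l : Fin N => (D.orderEmbOfFin hD l : ℕ) < m).card := by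
    rw [← Finset.card_map (D.orderEmbOfFin hD).toEmbedding]
    congr 1
    ext a
    simp only [Finset.mem_filter, Finset.mem_map, Finset.mem_univ, true_and]
    constructor
    · rintro ⟨ha, ham⟩
      have : a ∈ Set.range (D.orderEmbOfFin hD) := by
        rw [Finset.range_orderEmbOfFin]; exact ha
      obtain ⟨l, rfl⟩ := this
      exact ⟨l, ham, rfl⟩
    · rintro ⟨l, hl, rfl⟩
      exact ⟨Finset.orderEmbOfFin_mem _ _ _, hl⟩
  rw [hcard]
  constructor
  · intro h
    have hle : (Finset.univ.filter fun l' : Fin N => (l' : ℕ) < l + 1).card ≤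
        (Finset.univ.filter fun l : Fin N => (D.orderEmbOfFin hD l : ℕ) < m).card := by
      refine Finset.card_le_card (Finset.monotone_filter_right _ fun l' _ hl' => ?_)
      have : l' ≤ l := Fin.le_def.2 (Nat.lt_succ_iff.1 hl')
      exact (Fin.le_def.1 ((D.orderEmbOfFin hD).monotone this)).trans_lt h
    rw [card_filter_val_lt l.2] at hle
    exact hle
  · intro h
    by_contra hm
    have hle : (Finset.univ.filter fun l : Fin N => (D.orderEmbOfFin hD l : ℕ) < m).card ≤
        (Finset.univ.filter fun l' : Fin N => (l' : ℕ) < l).card := by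
      refine Finset.card_le_card (Finset.monotone_filter_right _ fun l' _ hl' => ?_)
      by_contra hll
      have : l ≤ l' := Fin.le_def.2 (not_lt.1 hll)
      exact hm ((Fin.le_def.1 ((D.orderEmbOfFin hD).monotone this)).trans_lt hl')
    rw [card_filter_val_lt l.2.le] at hle
    omega

/-- The cards among the `m` lowest are split between the picked ones and the remaining deck. -/
theorem card_deck_filter_add (c : (i : Fin n) → Fin (n - i)) {m : ℕ} (hm : m ≤ n) (i : ℕ)
    (hi : i ≤ n) :
    ((deck c i hi).1.filter fun a : Fin n => (a : ℕ) < m).card + countBelow (pickedPerm c) i m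
      = m := by
  induction i with
  | zero =>
    rw [countBelow_zero, add_zero]
    exact card_filter_val_lt hm
  | succ i ih =>
    have h := ih (by omega)
    have hs := countBelow_succ (pickedPerm c) ⟨i, hi⟩ m
    change countBelow _ (i + 1) m = countBelow _ i m +
      if (pickedCard c ⟨i, hi⟩ : ℕ) < m then 1 else 0 at hs
    rw [hs, deck_succ, Finset.filter_erase]
    have hmem : pickedCard c ⟨i, hi⟩ ∈ (deck c i (by omega)).1 :=
      Finset.orderEmbOfFin_mem _ _ _
    by_cases hp : (pickedCard c ⟨i, hi⟩ : ℕ) < m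
    · have hmem' := Finset.mem_filter (p := fun a : Fin n => (a : ℕ) < m).2 ⟨hmem, hp⟩
      have := Finset.card_erase_add_one hmem'
      rw [if_pos hp]
      omega
    · rw [if_neg hp, Finset.erase_eq_of_notMem (by simp [hp])]
      exact h

/-- The card picked in step `i` is among the `m` lowest if and only if the choice is smaller than
the number of such cards in the remaining deck. -/
theorem pickedPerm_lt_iff (c : (i : Fin n) → Fin (n - i)) {m : ℕ} (hm : m ≤ n) (i : Fin n) :
    (pickedPerm c i : ℕ) < m ↔ (c i : ℕ) + countBelow (pickedPerm c) i m < m := by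
  change (pickedCard c i : ℕ) < m ↔ _
  have h := card_deck_filter_add c hm i i.2.le
  rw [pickedCard, orderEmbOfFin_lt_iff]
  omega

/-- The number of remaining cards among the `m` lowest is `m` minus the number of picked ones, and
it is at most the size of the deck. -/
theorem le_sub_countBelow (c : (i : Fin n) → Fin (n - i)) {m : ℕ} (hm : m ≤ n) (i : Fin n) :
    countBelow (pickedPerm c) i m ≤ m ∧ m - countBelow (pickedPerm c) i m ≤ n - i := by
  have h := card_deck_filter_add c hm i i.2.le
  have h2 := Finset.card_filter_le (deck c i i.2.le).1 fun a : Fin n => (a : ℕ) < m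
  rw [(deck c i i.2.le).2] at h2
  omega

end Deck

/-! ### Second moments of the counting process -/

theorem natCast_div_mem_Icc {i n : ℕ} (hi : i ≤ n) : (i : ℝ) / n ∈ Icc (0 : ℝ) 1 :=
  ⟨by positivity, div_le_one_of_le₀ (by exact_mod_cast hi) (by positivity)⟩

theorem natCast_div_mem_Ico {i n : ℕ} (hi : i < n) : (i : ℝ) / n ∈ Ico (0 : ℝ) 1 := by
  have hn : (0 : ℝ) < n := by exact_mod_cast (Nat.zero_le i).trans_lt hi
  exact ⟨by positivity, (div_lt_one hn).2 (by exact_mod_cast hi)⟩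

theorem integral_permLaw (g : ℝ → ℝ) (n : ℕ) (f : Equiv.Perm (Fin n) → ℝ) :
    ∫ σ, f σ ∂permLaw g n = ∫ c, f (pickedPerm c) ∂Measure.pi (choiceLaw g n) :=
  integral_map (measurable_of_finite _).aemeasurable
    (Measurable.of_discrete.aestronglyMeasurable (f := f))

namespace Admissible

variable {g : ℝ → ℝ} {n : ℕ}

/-- The tail of the choice in step `i`: the sum of the weights telescopes. -/
theorem choiceLaw_real_le (hg : Admissible g) (i : Fin n) {R : ℕ} (hR : R ≤ n - i) :
    (choiceLaw g n i).real {x | R ≤ (x : ℕ)} = g (((i : ℝ) + R) / n) / g ((i : ℝ) / n) := by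
  classical
  have hn : (0 : ℝ) < n := by exact_mod_cast i.pos
  set G : ℕ → ℝ := fun l => g (((i : ℝ) + l) / n) / g ((i : ℝ) / n) with hG
  have hpos : 0 < g ((i : ℝ) / n) := hg.pos (natCast_div_mem_Ico i.2)
  have hmem : ∀ l : ℕ, l ≤ n - i → ((i : ℝ) + l) / n ∈ Icc (0 : ℝ) 1 := fun l hl => by
    have := natCast_div_mem_Icc (i := i + l) (n := n) (by omega)
    push_cast at this
    exact this
  have hterm : ∀ l : Fin (n - i), (g (((i : ℝ) + (l : ℝ)) / n) - g (((i : ℝ) + (l : ℝ) + 1) / n)) /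
      g ((i : ℝ) / n) = G l - G ((l : ℕ) + 1) := fun l => by
    simp only [hG, Nat.cast_add, Nat.cast_one, sub_div, add_assoc]
  have hnn : ∀ l : ℕ, l < n - i → 0 ≤ G l - G (l + 1) := fun l hl => by
    refine sub_nonneg.2 (div_le_div_of_nonneg_right ?_ hpos.le)
    refine hg.strictAntiOn.antitoneOn (hmem l hl.le) (hmem (l + 1) hl) ?_
    gcongr
    simp
  rw [measureReal_def, choiceLaw, Measure.finsetSum_apply]
  have happ : ∀ l : Fin (n - i), (ENNReal.ofReal
      ((g (((i : ℝ) + (l : ℝ)) / n) - g (((i : ℝ) + (l : ℝ) + 1) / n)) / g ((i : ℝ) / n)) •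
      Measure.dirac l : Measure (Fin (n - i))) {x | R ≤ (x : ℕ)} =
      ENNReal.ofReal (if R ≤ (l : ℕ) then G l - G ((l : ℕ) + 1) else 0) := fun l => by
    rw [hterm l, Measure.smul_apply, Measure.dirac_apply, smul_eq_mul, indicator_apply]
    simp only [mem_ofPred_eq, Pi.one_apply]
    split_ifs <;> simp
  rw [Finset.sum_congr rfl fun l _ => happ l, ← ENNReal.ofReal_sum_of_nonneg fun l _ => by
    split_ifs
    exacts [hnn l l.2, le_rfl], ENNReal.toReal_ofReal (Finset.sum_nonneg fun l _ => by
    split_ifs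
    exacts [hnn l l.2, le_rfl]),
    Fin.sum_univ_eq_sum_range (fun l => if R ≤ l then G l - G (l + 1) else 0) (n - i),
    ← Finset.sum_filter]
  have hfil : (Finset.range (n - i)).filter (fun l => R ≤ l) = Finset.Ico R (n - i) := by
    ext l
    simp [and_comm]
  have hend : G (n - i) = 0 := by
    have : ((i : ℝ) + ((n - i : ℕ) : ℝ)) / n = 1 := by
      rw [Nat.cast_sub i.2.le, add_sub_cancel, div_self hn.ne']
    simp only [hG, this, hg.map_one, zero_div]
  have hneg := Finset.sum_Ico_sub G hR
  rw [hfil]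
  rw [← neg_inj, ← Finset.sum_neg_distrib]
  simp only [neg_sub]
  rw [hneg, hend, zero_sub]

theorem isProbabilityMeasure_choiceLaw (hg : Admissible g) (i : Fin n) :
    IsProbabilityMeasure (choiceLaw g n i) := by
  have h := hg.choiceLaw_real_le i (Nat.zero_le _)
  rw [Nat.cast_zero, add_zero, div_self (hg.pos (natCast_div_mem_Ico i.2)).ne',
    measureReal_def] at h
  simp only [Nat.zero_le, ofPred_true] at h
  exact ⟨(ENNReal.toReal_eq_one_iff _).1 h⟩

theorem isProbabilityMeasure_permLaw (hg : Admissible g) (n : ℕ) :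
    IsProbabilityMeasure (permLaw g n) := by
  have := hg.isProbabilityMeasure_choiceLaw (n := n)
  exact Measure.isProbabilityMeasure_map (measurable_of_finite _).aemeasurable

theorem exists_cupCdf_sub_eq (hg : Admissible g) {y s x : ℝ} (hy : y ∈ Ico (0 : ℝ) 1) (hs : 0 ≤ s)
    (hsx : s < x) (hx : x ≤ 1) : ∃ ξ ∈ Ioo s x,
      cupCdf g x y - cupCdf g s y = g (cupCdf g ξ y) / g ξ * (x - s) := by
  obtain ⟨ξ, hξ, h⟩ := exists_hasDerivAt_eq_slope (fun x => cupCdf g x y)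
    (fun x => g (cupCdf g x y) / g x) hsx
    ((hg.continuousOn_cupCdf_left hy).mono (Icc_subset_Icc hs hx))
    fun z hz => hg.hasDerivAt_cupCdf_left ⟨hs.trans_lt hz.1, hz.2.trans_le hx⟩ hy
  refine ⟨ξ, hξ, ?_⟩
  rw [h, div_mul_cancel₀ _ (sub_pos.2 hsx).ne']

theorem abs_cupCdf_sub_le (hg : Admissible g) {y s x : ℝ} (hy : y ∈ Ico (0 : ℝ) 1) (hs : 0 ≤ s)
    (hsx : s ≤ x) (hx : x ≤ 1) : |cupCdf g x y - cupCdf g s y| ≤ x - s := by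
  rcases hsx.eq_or_lt with rfl | hsx
  · simp
  obtain ⟨ξ, hξ, h⟩ := hg.exists_cupCdf_sub_eq hy hs hsx hx
  have := hg.slope_mem ⟨hs.trans hξ.1.le, hξ.2.trans_le hx⟩ (Ico_subset_Icc_self hy)
  rw [h, abs_of_nonneg (mul_nonneg this.1 (sub_pos.2 hsx).le)]
  exact mul_le_of_le_one_left (sub_pos.2 hsx).le this.2

end Admissible

/-- The mean square distance between `v` and `Z / n`, where `Z = i + m - N` and `N` is the number
of the first `i` cards that are among the `m` lowest. The process `Z` goes up by one in step `i`
with conditional probability `g (Z / n) / g (i / n)`, and stays put otherwise. -/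
noncomputable def meanSq (g : ℝ → ℝ) (n m i : ℕ) (v : ℝ) : ℝ :=
  ∫ σ, (((i : ℝ) + m - countBelow σ i m) / n - v) ^ 2 ∂permLaw g n

theorem floor_mul_le {x : ℝ} (hx : x ≤ 1) (n : ℕ) : ⌊x * n⌋₊ ≤ n := by
  refine Nat.floor_le_of_le ?_
  exact mul_le_of_le_one_left (by positivity) hx

theorem floor_mul_div_mem {x : ℝ} (hx : 0 ≤ x) {n : ℕ} (hn : 0 < n) :
    (⌊x * n⌋₊ : ℝ) / n ≤ x ∧ x - (⌊x * n⌋₊ : ℝ) / n ≤ 1 / n := by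
  have hn' : (0 : ℝ) < n := by exact_mod_cast hn
  refine ⟨(div_le_iff₀ hn').2 (Nat.floor_le (by positivity)), ?_⟩
  rw [sub_le_iff_le_add, ← add_div, le_div_iff₀ hn', add_comm]
  exact (Nat.lt_floor_add_one _).le

namespace Admissible

variable {g : ℝ → ℝ} {n : ℕ}

/-- One step of the second moment estimate. As `g` is decreasing, the drift of the process pushes
it towards the solution of the differential equation, so that no Grönwall argument is needed. -/
theorem meanSq_succ_le (hg : Admissible g) {m : ℕ} (hm : m ≤ n) (i : Fin n) {v v' ε : ℝ}
    (hv : v ∈ Icc (0 : ℝ) 1) (h0 : 0 ≤ v' - v) (h1 : v' - v ≤ 1 / n)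
    (hε : |n * (v' - v) - g v / g ((i : ℝ) / n)| ≤ ε) :
    meanSq g n m (i + 1) v' ≤ meanSq g n m i v + (2 * ε / n + 1 / n ^ 2) := by
  have hprob := hg.isProbabilityMeasure_choiceLaw (n := n)
  have hn : (0 : ℝ) < n := by exact_mod_cast i.pos
  rw [meanSq, meanSq, integral_permLaw, integral_permLaw, integral_pi_update _ i]
  calc _ ≤ ∫ c, ((((i : ℕ) : ℝ) + m - countBelow (pickedPerm c) i m) / n - v) ^ 2 +
        (2 * ε / n + 1 / n ^ 2) ∂Measure.pi (choiceLaw g n) := ?_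
    _ = _ := by
        rw [integral_add Integrable.of_finite Integrable.of_finite, integral_const]
        simp
  refine integral_mono Integrable.of_finite Integrable.of_finite fun c => ?_
  simp only
  obtain ⟨hN, hR⟩ := le_sub_countBelow c hm i
  set N := countBelow (pickedPerm c) i m with hNdef
  set p := (choiceLaw g n i).real {x | m - N ≤ (x : ℕ)} with hp
  have hpg := hg.choiceLaw_real_le i hR
  rw [← hp, Nat.cast_sub hN] at hpg
  have hp01 : p ∈ Icc (0 : ℝ) 1 := ⟨measureReal_nonneg, measureReal_le_one⟩
  set a := ((i : ℝ) + m - N) / n - v with ha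
  set δ := v' - v with hδ
  have hval : ∀ x : Fin (n - i),
      ((((i + 1 : ℕ) : ℝ) + m - countBelow (pickedPerm (Function.update c i x)) (i + 1) m) / n
        - v') ^ 2 = (a - δ) ^ 2 +
          ({x : Fin (n - i) | m - N ≤ (x : ℕ)}.indicator 1 x) *
            ((a + 1 / n - δ) ^ 2 - (a - δ) ^ 2) := by
    intro x
    have hlt := pickedPerm_lt_iff (Function.update c i x) hm i
    rw [countBelow_update, Function.update_self, ← hNdef] at hlt
    rw [countBelow_succ, countBelow_update, ← hNdef]
    by_cases hx : m - N ≤ (x : ℕ)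
    · rw [if_neg (by rw [hlt]; omega), indicator_of_mem (by exact hx), Pi.one_apply, ha, hδ]
      push_cast
      field_simp
      ring
    · rw [if_pos (by rw [hlt]; omega), indicator_of_notMem (by exact hx), ha, hδ]
      push_cast
      field_simp
      ring
  rw [integral_congr_ae (Eventually.of_forall hval), integral_add Integrable.of_finite
    Integrable.of_finite, integral_const, integral_mul_const,
    integral_indicator_one (MeasurableSet.of_discrete), ← hp]
  simp only [probReal_univ, one_smul]
  have hZ : ((i : ℝ) + m - N) / n ∈ Icc (0 : ℝ) 1 := by
    have := natCast_div_mem_Icc (i := i + (m - N)) (n := n) (by omega)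
    rw [Nat.cast_add, Nat.cast_sub hN, ← add_sub_assoc] at this
    exact this
  have hgi : 0 < g ((i : ℝ) / n) := hg.pos (natCast_div_mem_Ico i.2)
  set q := g v / g ((i : ℝ) / n) with hq
  rw [← add_sub_assoc] at hpg
  have hapq : a * (p - q) ≤ 0 := by
    rw [hpg, hq, ← sub_div]
    rcases le_total v (((i : ℝ) + m - N) / n) with h | h
    · exact mul_nonpos_of_nonneg_of_nonpos (sub_nonneg.2 h) (div_nonpos_of_nonpos_of_nonneg
        (sub_nonpos.2 (hg.strictAntiOn.antitoneOn hv hZ h)) hgi.le)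
    · exact mul_nonpos_of_nonpos_of_nonneg (sub_nonpos.2 h) (div_nonneg
        (sub_nonneg.2 (hg.strictAntiOn.antitoneOn hZ hv h)) hgi.le)
  have haabs : |a| ≤ 1 := abs_le.2 ⟨by linarith [hZ.1, hv.2], by linarith [hZ.2, hv.1]⟩
  have haη : -(a * (n * δ - q)) ≤ ε := by
    have : |a * (n * δ - q)| ≤ 1 * ε := by
      rw [abs_mul]
      exact mul_le_mul haabs hε (abs_nonneg _) zero_le_one
    linarith [(abs_le.1 this).1]
  set w : ℝ := 1 / n with hw
  have hwn : w * n = 1 := by rw [hw]; field_simp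
  have hw0 : 0 ≤ w := by positivity
  have e1 : 2 * ε / n + 1 / (n : ℝ) ^ 2 = 2 * ε * w + w ^ 2 := by rw [hw]; ring
  rw [e1]
  -- the terms of second order are at most `w ^ 2`
  have e2 : p * (w - δ) ^ 2 + (1 - p) * δ ^ 2 ≤ w ^ 2 := by
    have h3 : (w - δ) ^ 2 ≤ w ^ 2 := by nlinarith
    have h4 : δ ^ 2 ≤ w ^ 2 := by nlinarith
    nlinarith [hp01.1, hp01.2]
  have e3 : 2 * a * (p * w - δ) ≤ 2 * ε * w := by
    have : 2 * a * (p * w - δ) = 2 * w * (a * (p - q) + -(a * (n * δ - q))) := by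
      linear_combination (-2 * a * δ) * (hwn.symm)
    rw [this]
    nlinarith
  nlinarith

theorem meanSq_le (hg : Admissible g) {y x₀ : ℝ} (hy : y ∈ Ico (0 : ℝ) 1) (hx₀ : x₀ < 1)
    {ε : ℝ} (hε : 0 < ε) : ∀ᶠ n : ℕ in atTop, ∀ m ≤ n, ∀ i : ℕ, (i : ℝ) / n ≤ x₀ →
      meanSq g n m i (cupCdf g ((i : ℝ) / n) y) ≤
        ((m : ℝ) / n - y) ^ 2 + i * (2 * ε / n + 1 / n ^ 2) := by
  have hsub : Icc 0 x₀ ⊆ Ico (0 : ℝ) 1 := fun z hz => ⟨hz.1, hz.2.trans_lt hx₀⟩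
  have hcont : ContinuousOn (fun x => g (cupCdf g x y) / g x) (Icc 0 x₀) := by
    refine ContinuousOn.div (hg.continuousOn.comp ((hg.continuousOn_cupCdf_left hy).mono
      (hsub.trans Ico_subset_Icc_self)) fun z hz => ?_)
      (hg.continuousOn.mono (hsub.trans Ico_subset_Icc_self)) fun z hz => (hg.pos (hsub hz)).ne'
    exact Ico_subset_Icc_self (hg.cupCdf_mem (hsub hz) hy)
  obtain ⟨δ, hδ, hunif⟩ := Metric.uniformContinuousOn_iff_le.1
    (isCompact_Icc.uniformContinuousOn_of_continuous hcont) ε hε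
  filter_upwards [(tendsto_const_div_atTop_nhds_zero_nat (1 : ℝ)).eventually (gt_mem_nhds hδ),
    eventually_gt_atTop 0] with n hnδ hn0 m hm i
  have hn : (0 : ℝ) < n := by exact_mod_cast hn0
  have := hg.isProbabilityMeasure_permLaw n
  induction i with
  | zero =>
    intro _
    simp [meanSq, countBelow_zero, hg.cupCdf_zero_left hy]
  | succ i ih =>
    intro hi
    have hlt : (i : ℝ) / n < ((i + 1 : ℕ) : ℝ) / n := by
      gcongr
      simp
    have hi1 : ((i + 1 : ℕ) : ℝ) < n := (div_lt_one hn).1 (hi.trans_lt hx₀)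
    have hin : i < n := by
      have : i + 1 < n := by exact_mod_cast hi1
      omega
    have hd : ((i + 1 : ℕ) : ℝ) / n - (i : ℝ) / n = 1 / n := by
      push_cast
      ring
    obtain ⟨ξ, hξ, hξe⟩ := hg.exists_cupCdf_sub_eq hy (by positivity) hlt (hi.trans hx₀.le)
    have hi0 : (0 : ℝ) ≤ (i : ℝ) / n := by positivity
    have hξm : ξ ∈ Icc 0 x₀ := ⟨hi0.trans hξ.1.le, hξ.2.le.trans hi⟩
    have hsl := hg.slope_mem (hsub hξm) (Ico_subset_Icc_self hy)
    rw [hd] at hξe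
    have h := hg.meanSq_succ_le hm ⟨i, hin⟩ (v := cupCdf g ((i : ℝ) / n) y)
      (v' := cupCdf g (((i + 1 : ℕ) : ℝ) / n) y) (ε := ε)
      (Ico_subset_Icc_self (hg.cupCdf_mem (natCast_div_mem_Ico hin) hy)) ?_ ?_ ?_
    · refine h.trans ?_
      have := ih (hlt.le.trans hi)
      simp only
      push_cast at this ⊢
      linarith
    · rw [hξe]
      exact mul_nonneg hsl.1 (by positivity)
    · rw [hξe]
      exact mul_le_of_le_one_left (by positivity) hsl.2
    · rw [hξe, mul_one_div, mul_div_cancel₀ _ hn.ne', ← Real.dist_eq]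
      refine hunif ξ hξm _ ⟨hi0, hlt.le.trans hi⟩ ?_
      rw [Real.dist_eq, abs_of_pos (sub_pos.2 hξ.1)]
      linarith [hξ.2]

/-- The fraction of the first `xn` cards of a `g`-random permutation that are among the `yn` lowest
cards, relative to `n`, converges in mean to `x + y - V_g(x,y)`. -/
theorem tendsto_integral_abs_countBelow (hg : Admissible g) {x y : ℝ} (hx : x ∈ Icc (0 : ℝ) 1)
    (hy : y ∈ Icc (0 : ℝ) 1) :
    Tendsto (fun n : ℕ => ∫ σ, |(countBelow σ ⌊x * n⌋₊ ⌊y * n⌋₊ : ℝ) / n -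
      (x + y - cupCdf g x y)| ∂permLaw g n) atTop (𝓝 0) := by
  have h1n := tendsto_const_div_atTop_nhds_zero_nat (1 : ℝ)
  have hbound : ∀ n : ℕ, (∀ σ : Equiv.Perm (Fin n), |(countBelow σ ⌊x * n⌋₊ ⌊y * n⌋₊ : ℝ) / n -
      (x + y - cupCdf g x y)| ≤ 1 / n) → ∫ σ, |(countBelow σ ⌊x * n⌋₊ ⌊y * n⌋₊ : ℝ) / n -
      (x + y - cupCdf g x y)| ∂permLaw g n ≤ 1 / n := fun n h => by
    have := hg.isProbabilityMeasure_permLaw n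
    refine (integral_mono Integrable.of_finite Integrable.of_finite h).trans ?_
    simp
  rcases hx.2.lt_or_eq with hx1 | rfl
  swap
  · refine tendsto_of_tendsto_of_tendsto_of_le_of_le' tendsto_const_nhds h1n
      (Eventually.of_forall fun n => integral_nonneg fun σ => abs_nonneg _) ?_
    filter_upwards [eventually_gt_atTop 0] with n hn
    refine hbound n fun σ => ?_
    rw [one_mul, Nat.floor_natCast, countBelow_full σ (floor_mul_le hy.2 n), cupCdf_one_left,
      add_sub_cancel_left, abs_sub_comm, abs_of_nonneg]
    exacts [(floor_mul_div_mem hy.1 hn).2, sub_nonneg.2 (floor_mul_div_mem hy.1 hn).1]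
  rcases hy.2.lt_or_eq with hy1 | rfl
  swap
  · refine tendsto_of_tendsto_of_tendsto_of_le_of_le' tendsto_const_nhds h1n
      (Eventually.of_forall fun n => integral_nonneg fun σ => abs_nonneg _) ?_
    filter_upwards [eventually_gt_atTop 0] with n hn
    refine hbound n fun σ => ?_
    rw [one_mul, Nat.floor_natCast, countBelow_all σ (floor_mul_le hx.2 n), cupCdf_one_right,
      add_sub_cancel_right, abs_sub_comm, abs_of_nonneg]
    exacts [(floor_mul_div_mem hx.1 hn).2, sub_nonneg.2 (floor_mul_div_mem hx.1 hn).1]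
  rw [tendsto_order]
  refine ⟨fun a ha => Eventually.of_forall fun n =>
    ha.trans_le (integral_nonneg fun σ => abs_nonneg _), fun ε hε => ?_⟩
  -- `|t| ≤ η + t² / η` turns the second moment estimate into a first moment one
  set η := ε / 4 with hη
  have hη0 : 0 < η := by positivity
  filter_upwards [hg.meanSq_le ⟨hy.1, hy1⟩ hx1 (show 0 < η ^ 2 / 4 by positivity),
    eventually_gt_atTop 0, h1n.eventually (gt_mem_nhds (show 0 < η / 3 by positivity)),
    h1n.eventually (gt_mem_nhds (show 0 < η ^ 2 / 4 by positivity)),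
    h1n.eventually (gt_mem_nhds zero_lt_one)] with n hms hn0 hn1 hn2 hn3
  have := hg.isProbabilityMeasure_permLaw n
  have hn : (0 : ℝ) < n := by exact_mod_cast hn0
  obtain ⟨hi1, hi2⟩ := floor_mul_div_mem hx.1 hn0
  obtain ⟨hm1, hm2⟩ := floor_mul_div_mem hy.1 hn0
  set i := ⌊x * n⌋₊
  set m := ⌊y * n⌋₊
  have hin : i ≤ n := floor_mul_le hx.2 n
  have h := hms m (floor_mul_le hy.2 n) i hi1
  have hV := hg.abs_cupCdf_sub_le ⟨hy.1, hy1⟩ (show (0 : ℝ) ≤ (i : ℝ) / n by positivity) hi1 hx.2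
  set v := cupCdf g ((i : ℝ) / n) y
  have hpt : ∀ σ : Equiv.Perm (Fin n), |(countBelow σ i m : ℝ) / n - (x + y - cupCdf g x y)| ≤
      η⁻¹ * (((i : ℝ) + m - countBelow σ i m) / n - v) ^ 2 + (η + 3 / n) := by
    intro σ
    set t := ((i : ℝ) + m - countBelow σ i m) / n - v with ht
    have h1 : (countBelow σ i m : ℝ) / n - (x + y - cupCdf g x y) =
        -t - (x - (i : ℝ) / n) - (y - (m : ℝ) / n) + (cupCdf g x y - v) := by
      rw [ht]
      ring
    have h2 : |t| ≤ η⁻¹ * t ^ 2 + η := by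
      rw [← sq_abs t]
      have h3 : 0 ≤ η⁻¹ * (|t| - η) ^ 2 := by positivity
      have h4 : η⁻¹ * (|t| - η) ^ 2 = η⁻¹ * |t| ^ 2 - 2 * |t| + η := by
        field_simp
        ring
      linarith [abs_nonneg t]
    have h3 := abs_le.1 (hV.trans hi2)
    have h4 : (3 : ℝ) / n = 3 * (1 / n) := by ring
    rw [h1, abs_le, h4]
    constructor <;> linarith [abs_le.1 (le_refl |t|), neg_abs_le t, le_abs_self t]
  calc _ ≤ ∫ σ, η⁻¹ * (((i : ℝ) + m - countBelow σ i m) / n - v) ^ 2 + (η + 3 / n)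
        ∂permLaw g n := integral_mono Integrable.of_finite Integrable.of_finite hpt
    _ = η⁻¹ * meanSq g n m i v + (η + 3 / n) := by
        rw [integral_add Integrable.of_finite Integrable.of_finite, integral_const_mul, meanSq]
        simp
    _ < ε := by
        have h5 : meanSq g n m i v ≤ η ^ 2 := by
          have h6 : ((m : ℝ) / n - y) ^ 2 ≤ 1 / n := by
            rw [← neg_sq, neg_sub]
            nlinarith
          have h7 : (i : ℝ) * (2 * (η ^ 2 / 4) / n + 1 / n ^ 2) ≤ η ^ 2 / 2 + 1 / n := by
            calc (i : ℝ) * (2 * (η ^ 2 / 4) / n + 1 / n ^ 2)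
                ≤ n * (2 * (η ^ 2 / 4) / n + 1 / n ^ 2) := by gcongr
              _ = η ^ 2 / 2 + 1 / n := by
                  field_simp
                  ring
          linarith
        have h8 : η⁻¹ * meanSq g n m i v ≤ η := by
          rw [inv_mul_le_iff₀ hη0, ← sq]
          exact h5
        have h9 : (3 : ℝ) / n = 3 * (1 / n) := by ring
        rw [h9]
        linarith

end Admissible

/-! ### Pattern densities of quantized measures -/

/-- The configurations of `k` points whose vertical order, read from left to right, is `τ`, for
points with coordinates in an arbitrary linear order. -/
def patternSet {k : ℕ} (α : Type*) [LinearOrder α] (τ : Equiv.Perm (Fin k)) :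
    Set (Fin k → α × α) :=
  {p | ∃ s : Equiv.Perm (Fin k), (∀ a b, a < b → (p (s a)).1 < (p (s b)).1) ∧
    ∀ a b, (p (s a)).2 < (p (s b)).2 ↔ τ a < τ b}

theorem permutonPatternDensity_eq {k : ℕ} (τ : Equiv.Perm (Fin k)) (μ : Measure (ℝ × ℝ)) :
    permutonPatternDensity τ μ = (Measure.pi fun _ : Fin k => μ).real (patternSet ℝ τ) := rfl

theorem measurableSet_patternSet {k : ℕ} (τ : Equiv.Perm (Fin k)) :
    MeasurableSet (patternSet ℝ τ) := by
  have h1 : ∀ i j : Fin k, Measurable fun p : Fin k → ℝ × ℝ => (p i).1 < (p j).1 := fun i j =>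
    measurableSet_setOfPred.1 (measurableSet_lt (by fun_prop) (by fun_prop))
  have h2 : ∀ i j : Fin k, Measurable fun p : Fin k → ℝ × ℝ => (p i).2 < (p j).2 := fun i j =>
    measurableSet_setOfPred.1 (measurableSet_lt (by fun_prop) (by fun_prop))
  refine measurableSet_setOfPred.2 (Measurable.exists fun s => Measurable.and ?_ ?_)
  · exact Measurable.forall fun a => Measurable.forall fun b => measurable_const.imp (h1 _ _)
  · exact Measurable.forall fun a => Measurable.forall fun b => (h2 _ _).iff measurable_const

section Quantize

variable {k : ℕ} {α β : Type*} [LinearOrder α] [LinearOrder β]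

theorem preimage_patternSet_subset (τ : Equiv.Perm (Fin k)) {Q : α → β} (hQ : Monotone Q) :
    (fun (p : Fin k → α × α) i => Prod.map Q Q (p i)) ⁻¹' patternSet β τ ⊆ patternSet α τ := by
  rintro p ⟨s, h1, h2⟩
  refine ⟨s, fun a b hab => hQ.reflect_lt (h1 a b hab), fun a b => ⟨fun h => ?_, fun h =>
    hQ.reflect_lt ((h2 a b).2 h)⟩⟩
  by_contra hτ
  rcases (not_lt.1 hτ).lt_or_eq with hlt | heq
  · exact lt_asymm h (hQ.reflect_lt ((h2 b a).2 hlt))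
  · rw [τ.injective heq] at h
    exact lt_irrefl _ h

/-- A pattern survives a monotone quantization unless two of the points get a common coordinate. -/
theorem patternSet_subset_union (τ : Equiv.Perm (Fin k)) {Q : α → β} (hQ : Monotone Q) :
    patternSet α τ ⊆ ((fun (p : Fin k → α × α) i => Prod.map Q Q (p i)) ⁻¹' patternSet β τ) ∪
      ((⋃ a : Fin k, ⋃ b ∈ Finset.univ.erase a, {p | Q (p a).1 = Q (p b).1}) ∪
        (⋃ a : Fin k, ⋃ b ∈ Finset.univ.erase a, {p | Q (p a).2 = Q (p b).2})) := by
  rintro p ⟨s, h1, h2⟩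
  by_cases hc : p ∈ ((⋃ a : Fin k, ⋃ b ∈ Finset.univ.erase a, {p | Q (p a).1 = Q (p b).1}) ∪
        (⋃ a : Fin k, ⋃ b ∈ Finset.univ.erase a, {p | Q (p a).2 = Q (p b).2}))
  · exact Or.inr hc
  simp only [mem_union, mem_iUnion, mem_ofPred_eq, not_or, not_exists, Finset.mem_erase,
    Finset.mem_univ, and_true] at hc
  refine Or.inl ⟨s, fun a b hab => ?_, fun a b => ⟨fun h => (h2 a b).1 (hQ.reflect_lt h),
    fun h => ?_⟩⟩
  · exact lt_of_le_of_ne (hQ (h1 a b hab).le) (hc.1 _ _ fun h => hab.ne (s.injective h).symm)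
  · exact lt_of_le_of_ne (hQ ((h2 a b).2 h).le)
      (hc.2 _ _ fun hs => h.ne (congrArg τ (s.injective hs).symm))

end Quantize

/-- If no value of `Φ` has probability more than `δ`, then two independent samples have the same
value with probability at most `δ`. -/
theorem pi_real_eq_le {S C : Type*} [MeasurableSpace S] [Fintype C] [MeasurableSpace C]
    [MeasurableSingletonClass C] {k : ℕ} (ν : Measure S) [IsProbabilityMeasure ν] {Φ : S → C}
    (hΦ : Measurable Φ) {δ : ℝ} (hδ : ∀ c, ν.real (Φ ⁻¹' {c}) ≤ δ) {a b : Fin k} (hab : b ≠ a) :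
    (Measure.pi fun _ : Fin k => ν).real {p | Φ (p a) = Φ (p b)} ≤ δ := by
  have hone : ∑ c, ν.real (Φ ⁻¹' {c}) = 1 := by
    rw [sum_measureReal_preimage_singleton _ fun c _ => hΦ (measurableSet_singleton c)]
    simp
  have hset : {p : Fin k → S | Φ (p a) = Φ (p b)} =
      ⋃ c, univ.pi fun i => if i = a ∨ i = b then Φ ⁻¹' {c} else univ := by
    ext p
    simp only [mem_ofPred_eq, mem_iUnion, mem_univ_pi]
    constructor
    · intro h
      refine ⟨Φ (p b), fun i => ?_⟩
      split_ifs with hi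
      · rcases hi with rfl | rfl
        exacts [h, rfl]
      · trivial
    · rintro ⟨c, hc⟩
      have ha := hc a
      have hb := hc b
      simp only [true_or, or_true, if_true] at ha hb
      exact (show Φ (p a) = c from ha).trans (show Φ (p b) = c from hb).symm
  rw [hset]
  calc _ ≤ ∑ c, (Measure.pi fun _ : Fin k => ν).real
        (univ.pi fun i => if i = a ∨ i = b then Φ ⁻¹' {c} else univ) :=
        measureReal_iUnion_fintype_le _
    _ = ∑ c, ν.real (Φ ⁻¹' {c}) * ν.real (Φ ⁻¹' {c}) := by
        refine Finset.sum_congr rfl fun c _ => ?_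
        rw [measureReal_def, Measure.pi_pi, ENNReal.toReal_prod]
        have : ∀ i : Fin k, (ν (if i = a ∨ i = b then Φ ⁻¹' {c} else univ)).toReal =
            if i ∈ ({a, b} : Finset (Fin k)) then ν.real (Φ ⁻¹' {c}) else 1 := fun i => by
          simp only [Finset.mem_insert, Finset.mem_singleton]
          split_ifs
          · rfl
          · simp
        rw [Finset.prod_congr rfl fun i _ => this i, Finset.prod_ite_mem, Finset.univ_inter,
          Finset.prod_const, Finset.card_pair hab.symm, sq]
    _ ≤ ∑ c, δ * ν.real (Φ ⁻¹' {c}) :=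
        Finset.sum_le_sum fun c _ => mul_le_mul_of_nonneg_right (hδ c) measureReal_nonneg
    _ = δ := by rw [← Finset.mul_sum, hone, mul_one]

theorem measureReal_iUnion_erase_le {Ω : Type*} [MeasurableSpace Ω] (P : Measure Ω)
    [IsProbabilityMeasure P] {k : ℕ} {S : Fin k → Fin k → Set Ω} {δ : ℝ} (hδ0 : 0 ≤ δ)
    (h : ∀ a b, b ≠ a → P.real (S a b) ≤ δ) :
    P.real (⋃ a : Fin k, ⋃ b ∈ Finset.univ.erase a, S a b) ≤ k ^ 2 * δ := by
  calc _ ≤ ∑ a : Fin k, P.real (⋃ b ∈ Finset.univ.erase a, S a b) :=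
        measureReal_iUnion_fintype_le _
    _ ≤ ∑ a : Fin k, ∑ b ∈ Finset.univ.erase a, P.real (S a b) :=
        Finset.sum_le_sum fun a _ => measureReal_biUnion_finset_le _ _
    _ ≤ ∑ _a : Fin k, ∑ _b : Fin k, δ := by
        refine Finset.sum_le_sum fun a _ => ?_
        refine (Finset.sum_le_sum fun b hb => h a b (Finset.ne_of_mem_erase hb)).trans ?_
        exact Finset.sum_le_sum_of_subset_of_nonneg (Finset.erase_subset _ _) fun _ _ _ => hδ0
    _ = k ^ 2 * δ := by
        simp only [Finset.sum_const, Finset.card_univ, Fintype.card_fin, nsmul_eq_mul]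
        ring

/-- Quantizing the coordinates changes a pattern probability by at most the probability that two
points fall into the same column or the same row. -/
theorem abs_sub_quantize_le {k M : ℕ} (τ : Equiv.Perm (Fin k)) (ν : Measure (ℝ × ℝ))
    [IsProbabilityMeasure ν] {Q : ℝ → Fin M} (hQ : Monotone Q) {δ : ℝ} (hδ0 : 0 ≤ δ)
    (hcol : ∀ j, ν.real ((fun p => Q p.1) ⁻¹' {j}) ≤ δ)
    (hrow : ∀ j, ν.real ((fun p => Q p.2) ⁻¹' {j}) ≤ δ) :
    |permutonPatternDensity τ ν -
      (Measure.pi fun _ : Fin k => ν.map (Prod.map Q Q)).real (patternSet (Fin M) τ)| ≤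
      2 * k ^ 2 * δ := by
  have hQm : Measurable Q := hQ.measurable
  have hQQ : Measurable (Prod.map Q Q) := hQm.prodMap hQm
  have hprob : IsProbabilityMeasure (ν.map (Prod.map Q Q)) :=
    Measure.isProbabilityMeasure_map hQQ.aemeasurable
  have hmap : (Measure.pi fun _ : Fin k => ν.map (Prod.map Q Q)).real (patternSet (Fin M) τ) =
      (Measure.pi fun _ : Fin k => ν).real
        ((fun (p : Fin k → ℝ × ℝ) i => Prod.map Q Q (p i)) ⁻¹' patternSet (Fin M) τ) := by
    rw [← Measure.pi_map_pi fun _ => hQQ.aemeasurable, map_measureReal_apply _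
      (MeasurableSet.of_discrete)]
    exact measurable_pi_lambda _ fun i => hQQ.comp (measurable_pi_apply i)
  rw [hmap, permutonPatternDensity_eq]
  have h1 := measureReal_mono (μ := Measure.pi fun _ : Fin k => ν)
    (preimage_patternSet_subset τ hQ)
  have h2 := (measureReal_mono (μ := Measure.pi fun _ : Fin k => ν)
    (patternSet_subset_union τ hQ)).trans ((measureReal_union_le _ _).trans
      (add_le_add le_rfl (measureReal_union_le _ _)))
  have h3 := measureReal_iUnion_erase_le (Measure.pi fun _ : Fin k => ν)
    (S := fun a b => {p | Q (p a).1 = Q (p b).1}) hδ0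
    fun a b hab => pi_real_eq_le ν (hQm.comp measurable_fst) hcol hab
  have h4 := measureReal_iUnion_erase_le (Measure.pi fun _ : Fin k => ν)
    (S := fun a b => {p | Q (p a).2 = Q (p b).2}) hδ0
    fun a b hab => pi_real_eq_le ν (hQm.comp measurable_snd) hrow hab
  rw [abs_of_nonneg (sub_nonneg.2 h1)]
  linarith

theorem abs_prod_sub_prod_le {ι : Type*} (s : Finset ι) (f f' : ι → ℝ)
    (hf : ∀ i ∈ s, f i ∈ Icc (0 : ℝ) 1) (hf' : ∀ i ∈ s, f' i ∈ Icc (0 : ℝ) 1) :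
    |∏ i ∈ s, f i - ∏ i ∈ s, f' i| ≤ ∑ i ∈ s, |f i - f' i| := by
  classical
  induction s using Finset.induction_on with
  | empty => simp
  | insert a s ha ih =>
    rw [Finset.prod_insert ha, Finset.prod_insert ha, Finset.sum_insert ha]
    have ih := ih (fun i hi => hf i (Finset.mem_insert_of_mem hi))
      fun i hi => hf' i (Finset.mem_insert_of_mem hi)
    have hp : |∏ i ∈ s, f i| ≤ 1 := by
      rw [Finset.abs_prod]
      refine Finset.prod_le_one (fun i _ => abs_nonneg _) fun i hi => ?_
      have := hf i (Finset.mem_insert_of_mem hi)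
      exact abs_le.2 ⟨by linarith [this.1], this.2⟩
    have ha' := hf' a (Finset.mem_insert_self a s)
    calc |f a * ∏ i ∈ s, f i - f' a * ∏ i ∈ s, f' i|
        = |(f a - f' a) * ∏ i ∈ s, f i + f' a * (∏ i ∈ s, f i - ∏ i ∈ s, f' i)| := by
          congr 1
          ring
      _ ≤ |f a - f' a| * |∏ i ∈ s, f i| + |f' a| * |∏ i ∈ s, f i - ∏ i ∈ s, f' i| := by
          rw [← abs_mul, ← abs_mul]
          exact abs_add_le _ _
      _ ≤ |f a - f' a| * 1 + 1 * ∑ i ∈ s, |f i - f' i| := by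
          gcongr
          exact abs_le.2 ⟨by linarith [ha'.1], ha'.2⟩
      _ = _ := by ring

section FiniteSpace

variable {C : Type*} [Fintype C] [MeasurableSpace C] [MeasurableSingletonClass C]

theorem measureReal_sub_le_sum (ρ ρ' : Measure C) [IsProbabilityMeasure ρ]
    [IsProbabilityMeasure ρ'] (S : Set C) :
    ρ.real S - ρ'.real S ≤ ∑ x, |ρ.real {x} - ρ'.real {x}| := by
  classical
  have h : ∀ ρ : Measure C, ∀ [IsProbabilityMeasure ρ],
      ρ.real S = ∑ x ∈ S.toFinset, ρ.real {x} := fun ρ _ => by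
    rw [sum_measureReal_singleton, coe_toFinset]
  rw [h ρ, h ρ', ← Finset.sum_sub_distrib]
  exact (Finset.sum_le_sum fun x _ => le_abs_self _).trans
    (Finset.sum_le_sum_of_subset_of_nonneg (Finset.subset_univ _) fun _ _ _ => abs_nonneg _)

/-- A crude bound for the distance of the `k`-fold products of two probability measures on a finite
space. -/
theorem abs_pi_real_sub_le (ρ ρ' : Measure C) [IsProbabilityMeasure ρ] [IsProbabilityMeasure ρ']
    {k : ℕ} (A : Set (Fin k → C)) :
    |(Measure.pi fun _ : Fin k => ρ).real A - (Measure.pi fun _ : Fin k => ρ').real A| ≤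
      (Fintype.card C : ℝ) ^ k * (k * ∑ x, |ρ.real {x} - ρ'.real {x}|) := by
  classical
  have h : ∀ ρ : Measure C, ∀ [IsProbabilityMeasure ρ],
      (Measure.pi fun _ : Fin k => ρ).real A = ∑ c ∈ A.toFinset, ∏ i, ρ.real {c i} := fun ρ _ => by
    conv_lhs => rw [← coe_toFinset A, ← sum_measureReal_singleton]
    refine Finset.sum_congr rfl fun c _ => ?_
    simp only [measureReal_def, Measure.pi_singleton, ENNReal.toReal_prod]
  rw [h ρ, h ρ', ← Finset.sum_sub_distrib]
  calc _ ≤ ∑ c ∈ A.toFinset, |∏ i, ρ.real {c i} - ∏ i, ρ'.real {c i}| :=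
        Finset.abs_sum_le_sum_abs _ _
    _ ≤ ∑ _c : Fin k → C, (k * ∑ x, |ρ.real {x} - ρ'.real {x}|) := by
        refine (Finset.sum_le_sum fun c _ => ?_).trans (Finset.sum_le_sum_of_subset_of_nonneg
          (Finset.subset_univ _) fun _ _ _ => by positivity)
        refine (abs_prod_sub_prod_le _ _ _ (fun i _ => ⟨measureReal_nonneg, measureReal_le_one⟩)
          fun i _ => ⟨measureReal_nonneg, measureReal_le_one⟩).trans ?_
        refine (Finset.sum_le_card_nsmul _ _ (∑ x, |ρ.real {x} - ρ'.real {x}|) fun i _ => ?_).trans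
          (by simp)
        exact Finset.single_le_sum (f := fun x => |ρ.real {x} - ρ'.real {x}|)
          (fun _ _ => abs_nonneg _) (Finset.mem_univ (c i))
    _ = _ := by simp

end FiniteSpace

/-! ### Pattern densities and joint distribution functions -/

/-- The index of the cell of the regular partition of `(0,1]` into `M + 1` half-open intervals that
contains `x`, with clipping outside `(0,1]` so that the map is monotone on `ℝ`. -/
noncomputable def gridIndex (M : ℕ) (x : ℝ) : Fin (M + 1) :=
  ⟨min (⌈((M : ℝ) + 1) * x⌉₊ - 1) M, by omega⟩

theorem monotone_gridIndex (M : ℕ) : Monotone (gridIndex M) := fun x y hxy => by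
  rw [Fin.le_def]
  exact min_le_min_right _ (Nat.sub_le_sub_right (Nat.ceil_mono (by gcongr)) 1)

theorem gridIndex_eq_iff {M : ℕ} {x : ℝ} (hx : x ∈ Ioc (0 : ℝ) 1) (j : Fin (M + 1)) :
    gridIndex M x = j ↔ x ∈ Ioc ((j : ℝ) / ((M : ℝ) + 1)) (((j : ℝ) + 1) / ((M : ℝ) + 1)) := by
  have hM : (0 : ℝ) < (M : ℝ) + 1 := by positivity
  have h1 : 0 < ⌈((M : ℝ) + 1) * x⌉₊ := Nat.ceil_pos.2 (mul_pos hM hx.1)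
  have h2 : ⌈((M : ℝ) + 1) * x⌉₊ ≤ M + 1 := by
    rw [Nat.ceil_le]
    push_cast
    nlinarith [hx.2]
  have h3 : gridIndex M x = j ↔ ⌈((M : ℝ) + 1) * x⌉₊ = (j : ℕ) + 1 := by
    rw [Fin.ext_iff, gridIndex]
    simp only
    omega
  rw [h3, Nat.ceil_eq_iff (Nat.succ_ne_zero _), mem_Ioc, div_lt_iff₀ hM, le_div_iff₀ hM]
  simp [mul_comm]

theorem measureReal_Ioc_prod {ν : Measure (ℝ × ℝ)} [IsFiniteMeasure ν] {a b : ℝ} (hab : a ≤ b)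
    {S : Set ℝ} (hS : MeasurableSet S) :
    ν.real (Ioc a b ×ˢ S) = ν.real (Iic b ×ˢ S) - ν.real (Iic a ×ˢ S) := by
  rw [← Iic_union_Ioc_eq_Iic hab, union_prod, measureReal_union _ (measurableSet_Ioc.prod hS)]
  · ring
  · exact Disjoint.set_prod_left (Iic_disjoint_Ioc le_rfl) _ _

theorem measureReal_prod_Ioc {ν : Measure (ℝ × ℝ)} [IsFiniteMeasure ν] {c d : ℝ} (hcd : c ≤ d)
    {S : Set ℝ} (hS : MeasurableSet S) :
    ν.real (S ×ˢ Ioc c d) = ν.real (S ×ˢ Iic d) - ν.real (S ×ˢ Iic c) := by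
  rw [← Iic_union_Ioc_eq_Iic hcd, prod_union, measureReal_union _ (hS.prod measurableSet_Ioc)]
  · ring
  · exact Disjoint.set_prod_right (Iic_disjoint_Ioc le_rfl) _ _

theorem measureReal_Ioc_prod_Ioc {ν : Measure (ℝ × ℝ)} [IsFiniteMeasure ν] {a b c d : ℝ}
    (hab : a ≤ b) (hcd : c ≤ d) : ν.real (Ioc a b ×ˢ Ioc c d) =
      jointCdf ν b d - jointCdf ν b c - (jointCdf ν a d - jointCdf ν a c) := by
  rw [measureReal_Ioc_prod hab measurableSet_Ioc, measureReal_prod_Ioc hcd measurableSet_Iic,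
    measureReal_prod_Ioc hcd measurableSet_Iic]
  rfl

/-- The law of the cell that contains a point of law `ν`. -/
noncomputable def gridLaw (M : ℕ) (ν : Measure (ℝ × ℝ)) : Measure (Fin (M + 1) × Fin (M + 1)) :=
  ν.map (Prod.map (gridIndex M) (gridIndex M))

theorem measurable_gridIndex (M : ℕ) : Measurable (gridIndex M) := (monotone_gridIndex M).measurable

theorem measurable_prodMap_gridIndex (M : ℕ) :
    Measurable (Prod.map (gridIndex M) (gridIndex M)) :=
  (measurable_gridIndex M).prodMap (measurable_gridIndex M)

theorem isProbabilityMeasure_gridLaw (M : ℕ) (ν : Measure (ℝ × ℝ)) [IsProbabilityMeasure ν] :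
    IsProbabilityMeasure (gridLaw M ν) :=
  Measure.isProbabilityMeasure_map (measurable_prodMap_gridIndex M).aemeasurable

theorem gridLaw_real_singleton {M : ℕ} {ν : Measure (ℝ × ℝ)} [IsProbabilityMeasure ν]
    (hν : ∀ᵐ p ∂ν, p ∈ Ioc (0 : ℝ) 1 ×ˢ Ioc (0 : ℝ) 1) (c : Fin (M + 1) × Fin (M + 1)) :
    (gridLaw M ν).real {c} =
      jointCdf ν (((c.1 : ℝ) + 1) / ((M : ℝ) + 1)) (((c.2 : ℝ) + 1) / ((M : ℝ) + 1)) -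
        jointCdf ν (((c.1 : ℝ) + 1) / ((M : ℝ) + 1)) ((c.2 : ℝ) / ((M : ℝ) + 1)) -
        (jointCdf ν ((c.1 : ℝ) / ((M : ℝ) + 1)) (((c.2 : ℝ) + 1) / ((M : ℝ) + 1)) -
          jointCdf ν ((c.1 : ℝ) / ((M : ℝ) + 1)) ((c.2 : ℝ) / ((M : ℝ) + 1))) := by
  rw [← measureReal_Ioc_prod_Ioc (by gcongr; simp) (by gcongr; simp), gridLaw,
    map_measureReal_apply (measurable_prodMap_gridIndex M) (MeasurableSet.of_discrete)]
  refine measureReal_congr ?_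
  filter_upwards [hν] with p hp
  refine propext ?_
  change Prod.map (gridIndex M) (gridIndex M) p = c ↔ _
  rw [Prod.ext_iff, Prod.map_fst, Prod.map_snd, gridIndex_eq_iff hp.1, gridIndex_eq_iff hp.2]
  rfl

theorem volume_gridIndex_preimage_le {M : ℕ} (j : Fin (M + 1)) :
    ((volume : Measure ℝ).restrict (Icc 0 1)).real (gridIndex M ⁻¹' {j}) ≤ 1 / ((M : ℝ) + 1) := by
  rw [← Measure.restrict_congr_set Ioc_ae_eq_Icc,
    measureReal_restrict_apply (measurable_gridIndex M (measurableSet_singleton j))]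
  calc _ ≤ (volume : Measure ℝ).real
        (Ioc ((j : ℝ) / ((M : ℝ) + 1)) (((j : ℝ) + 1) / ((M : ℝ) + 1))) := by
        refine measureReal_mono (fun x hx => (gridIndex_eq_iff hx.2 j).1 hx.1) ?_
        simp
    _ = 1 / ((M : ℝ) + 1) := by
        rw [Real.volume_real_Ioc_of_le (by gcongr; simp)]
        ring

namespace IsPermuton

variable {μ : Measure (ℝ × ℝ)}

theorem ae_mem (hμ : IsPermuton μ) : ∀ᵐ p ∂μ, p ∈ Ioc (0 : ℝ) 1 ×ˢ Ioc (0 : ℝ) 1 := by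
  have h : ∀ᵐ x ∂(volume : Measure ℝ).restrict (Icc 0 1), x ∈ Ioc (0 : ℝ) 1 := by
    rw [← Measure.restrict_congr_set Ioc_ae_eq_Icc]
    exact ae_restrict_mem measurableSet_Ioc
  have h1 := ae_of_ae_map measurable_fst.aemeasurable (hμ.map_fst ▸ h)
  have h2 := ae_of_ae_map measurable_snd.aemeasurable (hμ.map_snd ▸ h)
  filter_upwards [h1, h2] with p hp1 hp2
  exact ⟨hp1, hp2⟩

theorem real_column_le (hμ : IsPermuton μ) {M : ℕ} (j : Fin (M + 1)) :
    μ.real ((fun p => gridIndex M p.1) ⁻¹' {j}) ≤ 1 / ((M : ℝ) + 1) := by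
  rw [← Function.comp_def (gridIndex M) Prod.fst, preimage_comp, ← map_measureReal_apply
    measurable_fst (measurable_gridIndex M (measurableSet_singleton j)), hμ.map_fst]
  exact volume_gridIndex_preimage_le j

theorem real_row_le (hμ : IsPermuton μ) {M : ℕ} (j : Fin (M + 1)) :
    μ.real ((fun p => gridIndex M p.2) ⁻¹' {j}) ≤ 1 / ((M : ℝ) + 1) := by
  rw [← Function.comp_def (gridIndex M) Prod.snd, preimage_comp, ← map_measureReal_apply
    measurable_snd (measurable_gridIndex M (measurableSet_singleton j)), hμ.map_snd]
  exact volume_gridIndex_preimage_le j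

/-- Pattern densities with respect to a permuton are continuous: a probability measure with nearly
the same cell masses has nearly the same pattern densities. -/
theorem abs_permutonPatternDensity_sub_le (hμ : IsPermuton μ) (ν : Measure (ℝ × ℝ))
    [IsProbabilityMeasure ν] {k : ℕ} (τ : Equiv.Perm (Fin k)) (M : ℕ) :
    |permutonPatternDensity τ ν - permutonPatternDensity τ μ| ≤
      4 * k ^ 2 * (1 / ((M : ℝ) + 1)) +
        (2 * k ^ 2 + (Fintype.card (Fin (M + 1) × Fin (M + 1)) : ℝ) ^ k * k) *
          ∑ c, |(gridLaw M ν).real {c} - (gridLaw M μ).real {c}| := by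
  have := hμ.isProbabilityMeasure
  have := isProbabilityMeasure_gridLaw M ν
  have := isProbabilityMeasure_gridLaw M μ
  set D := ∑ c, |(gridLaw M ν).real {c} - (gridLaw M μ).real {c}| with hD
  have hD0 : 0 ≤ D := Finset.sum_nonneg fun _ _ => abs_nonneg _
  -- the rows and columns of `ν` are nearly as light as those of `μ`
  have htrans : ∀ S : Set (Fin (M + 1) × Fin (M + 1)),
      μ.real (Prod.map (gridIndex M) (gridIndex M) ⁻¹' S) ≤ 1 / ((M : ℝ) + 1) →
      ν.real (Prod.map (gridIndex M) (gridIndex M) ⁻¹' S) ≤ 1 / ((M : ℝ) + 1) + D := by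
    intro S hS
    have h := measureReal_sub_le_sum (gridLaw M ν) (gridLaw M μ) S
    have hap : ∀ ν : Measure (ℝ × ℝ), (gridLaw M ν).real S =
        ν.real (Prod.map (gridIndex M) (gridIndex M) ⁻¹' S) := fun ν =>
      map_measureReal_apply (measurable_prodMap_gridIndex M) (MeasurableSet.of_discrete)
    rw [hap, hap] at h
    linarith
  have h1 := abs_sub_quantize_le τ ν (monotone_gridIndex M) (δ := 1 / ((M : ℝ) + 1) + D)
    (by positivity) (fun j => htrans {c | c.1 = j} (hμ.real_column_le j))
    fun j => htrans {c | c.2 = j} (hμ.real_row_le j)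
  have h2 := abs_sub_quantize_le τ μ (monotone_gridIndex M) (δ := 1 / ((M : ℝ) + 1))
    (by positivity) hμ.real_column_le hμ.real_row_le
  have h3 := abs_pi_real_sub_le (gridLaw M ν) (gridLaw M μ) (patternSet (Fin (M + 1)) τ)
  rw [← hD] at h3
  unfold gridLaw at h3
  rw [abs_le] at h1 h2 h3 ⊢
  constructor <;> linarith [h1.1, h1.2, h2.1, h2.2, h3.1, h3.2]

end IsPermuton

/-! ### The empirical measure of a permutation -/

/-- The empirical measure of a permutation, the uniform distribution on its rescaled graph. -/
noncomputable def empiricalMeasure {n : ℕ} (σ : Equiv.Perm (Fin n)) : Measure (ℝ × ℝ) :=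
  (uniformOn univ : Measure (Fin n)).map fun i : Fin n => (((i : ℝ) + 1) / n, ((σ i : ℝ) + 1) / n)

section Empirical

variable {n : ℕ} (σ : Equiv.Perm (Fin n))

theorem measureReal_uniformOn_univ {S : Type*} [Fintype S] [MeasurableSpace S]
    [MeasurableSingletonClass S] (s : Set S) [DecidablePred (· ∈ s)] :
    (uniformOn univ : Measure S).real s =
      ((Finset.univ.filter (· ∈ s)).card : ℝ) / Fintype.card S := by
  rw [measureReal_def, uniformOn_univ, ENNReal.toReal_div, ENNReal.toReal_natCast]
  congr 1
  have : s = ↑(Finset.univ.filter (· ∈ s)) := by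
    ext
    simp
  conv_lhs => rw [this]
  rw [Measure.count_apply_finset, ENNReal.toReal_natCast]

theorem isProbabilityMeasure_empiricalMeasure (hn : 0 < n) :
    IsProbabilityMeasure (empiricalMeasure σ) := by
  have : Nonempty (Fin n) := ⟨⟨0, hn⟩⟩
  exact Measure.isProbabilityMeasure_map (measurable_of_finite _).aemeasurable

theorem empiricalMeasure_ae_mem :
    ∀ᵐ p ∂empiricalMeasure σ, p ∈ Ioc (0 : ℝ) 1 ×ˢ Ioc (0 : ℝ) 1 := by
  refine (ae_map_iff (measurable_of_finite _).aemeasurable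
    (measurableSet_Ioc.prod measurableSet_Ioc)).2 ?_
  refine Eventually.of_forall fun i => ?_
  have hn : (0 : ℝ) < n := by exact_mod_cast i.pos
  have h : ∀ j : Fin n, ((j : ℝ) + 1) / n ∈ Ioc (0 : ℝ) 1 := fun j =>
    ⟨by positivity, (div_le_one hn).2 (by exact_mod_cast j.2)⟩
  exact ⟨h i, h (σ i)⟩

theorem jointCdf_empiricalMeasure {x y : ℝ} (hx : 0 ≤ x) (hy : 0 ≤ y) :
    jointCdf (empiricalMeasure σ) x y = (countBelow σ ⌊x * n⌋₊ ⌊y * n⌋₊ : ℝ) / n := by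
  classical
  rw [jointCdf, empiricalMeasure, map_measureReal_apply (measurable_of_finite _)
    (measurableSet_Iic.prod measurableSet_Iic), measureReal_uniformOn_univ, Fintype.card_fin,
    countBelow]
  congr 3
  ext i
  have hn : (0 : ℝ) < n := by exact_mod_cast i.pos
  have h : ∀ (j : Fin n) {z : ℝ}, 0 ≤ z → (((j : ℝ) + 1) / n ≤ z ↔ (j : ℕ) < ⌊z * n⌋₊) :=
    fun j z hz => by
      rw [div_le_iff₀ hn, ← Nat.succ_le_iff, Nat.le_floor_iff (by positivity)]
      push_cast
      rfl
  simp only [Finset.mem_filter, Finset.mem_univ, true_and, mem_preimage, mem_prod, mem_Iic,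
    h i hx, h (σ i) hy]

/-- Each occurrence of a pattern accounts for `k!` samples from the empirical measure, one for each
order of the `k` points. -/
theorem card_samples_eq {k : ℕ} (τ : Equiv.Perm (Fin k))
    [DecidablePred fun e : Fin k → Fin n => ∃ s : Equiv.Perm (Fin k), StrictMono (e ∘ s) ∧
      ∀ a b, σ (e (s a)) < σ (e (s b)) ↔ τ a < τ b]
    [DecidablePred fun e : Fin k → Fin n =>
      StrictMono e ∧ ∀ a b, σ (e a) < σ (e b) ↔ τ a < τ b] :
    (Finset.univ.filter fun e : Fin k → Fin n => ∃ s : Equiv.Perm (Fin k), StrictMono (e ∘ s) ∧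
      ∀ a b, σ (e (s a)) < σ (e (s b)) ↔ τ a < τ b).card = k.factorial *
    (Finset.univ.filter fun e : Fin k → Fin n =>
      StrictMono e ∧ ∀ a b, σ (e a) < σ (e b) ↔ τ a < τ b).card := by
  have hfact : k.factorial = (Finset.univ : Finset (Equiv.Perm (Fin k))).card := by
    rw [Finset.card_univ, Fintype.card_perm, Fintype.card_fin]
  rw [hfact, ← Finset.card_product]
  symm
  refine Finset.card_bij (fun q _ => q.2 ∘ q.1.symm) ?_ ?_ ?_
  · rintro ⟨s, e⟩ hq
    simp only [Finset.mem_product, Finset.mem_univ, true_and, Finset.mem_filter] at hq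
    simp only [Finset.mem_filter, Finset.mem_univ, true_and]
    refine ⟨s, ?_, fun a b => ?_⟩
    · rw [Function.comp_assoc, Equiv.symm_comp_self]
      exact hq.1
    · simpa using hq.2 a b
  · rintro ⟨s, e⟩ hq ⟨s', e'⟩ hq' h
    simp only [Finset.mem_product, Finset.mem_univ, true_and, Finset.mem_filter] at hq hq'
    simp only at h
    have he : e = e' := by
      refine (StrictMono.range_inj hq.1 hq'.1).1 ?_
      rw [← s.symm.surjective.range_comp e, h, s'.symm.surjective.range_comp e']
    subst he
    have : s.symm = s'.symm := Equiv.ext fun a => hq.1.injective (congrFun h a)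
    rw [← s.symm_symm, this, s'.symm_symm]
  · intro e he
    simp only [Finset.mem_filter, Finset.mem_univ, true_and] at he
    obtain ⟨s, h1, h2⟩ := he
    refine ⟨(s, e ∘ s), ?_, ?_⟩
    · simp only [Finset.mem_product, Finset.mem_univ, true_and, Finset.mem_filter]
      exact ⟨h1, h2⟩
    · simp only [Function.comp_assoc, Equiv.self_comp_symm, Function.comp_id]

/-- Sampling `k` points with replacement from a permutation. -/
theorem permutonPatternDensity_empiricalMeasure {k : ℕ} (τ : Equiv.Perm (Fin k)) (hn : 0 < n)
    (hkn : k ≤ n) : permutonPatternDensity τ (empiricalMeasure σ) =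
      patternDensity τ σ * ((n.descFactorial k : ℝ) / (n : ℝ) ^ k) := by
  classical
  have := isProbabilityMeasure_empiricalMeasure σ hn
  have hn' : (0 : ℝ) < n := by exact_mod_cast hn
  set pt : Fin n → ℝ × ℝ := fun i => (((i : ℝ) + 1) / n, ((σ i : ℝ) + 1) / n) with hpt
  have hmeas : Measurable pt := measurable_of_finite _
  have hsf : SigmaFinite ((uniformOn univ : Measure (Fin n)).map pt) := by
    change SigmaFinite (empiricalMeasure σ)
    infer_instance
  rw [permutonPatternDensity_eq]
  unfold empiricalMeasure
  rw [← hpt, ← Measure.pi_map_pi (fun _ => hmeas.aemeasurable), map_measureReal_apply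
    (measurable_of_finite _) (measurableSet_patternSet τ), ← uniformOn_pi, pi_univ,
    measureReal_uniformOn_univ]
  have hset : (Finset.univ.filter fun e : Fin k → Fin n =>
      e ∈ (fun (e : Fin k → Fin n) i => pt (e i)) ⁻¹' patternSet ℝ τ) =
      Finset.univ.filter fun e : Fin k → Fin n => ∃ s : Equiv.Perm (Fin k), StrictMono (e ∘ s) ∧
      ∀ a b, σ (e (s a)) < σ (e (s b)) ↔ τ a < τ b := by
    ext e
    have hlt : ∀ i j : Fin n, ((i : ℝ) + 1) / n < ((j : ℝ) + 1) / n ↔ i < j := fun i j => by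
      rw [div_lt_div_iff_of_pos_right hn', add_lt_add_iff_right, Nat.cast_lt, Fin.lt_def]
    simp only [Finset.mem_filter, Finset.mem_univ, true_and, mem_preimage, patternSet,
      mem_ofPred_eq, hpt, hlt]
    rfl
  rw [hset, card_samples_eq, patternDensity, Nat.descFactorial_eq_factorial_mul_choose]
  have hch : (n.choose k : ℝ) ≠ 0 := by exact_mod_cast (Nat.choose_pos hkn).ne'
  simp only [Fintype.card_fun, Fintype.card_fin]
  push_cast
  field_simp

end Empirical

theorem abs_alternating_sub_le (a b c d a' b' c' d' : ℝ) :
    |a - b - (c - d) - (a' - b' - (c' - d'))| ≤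
      |a - a'| + |b - b'| + (|c - c'| + |d - d'|) := by
  rw [abs_le]
  constructor <;>
    linarith [neg_abs_le (a - a'), le_abs_self (a - a'), neg_abs_le (b - b'), le_abs_self (b - b'),
      neg_abs_le (c - c'), le_abs_self (c - c'), neg_abs_le (d - d'), le_abs_self (d - d')]

/-- Convergence in mean of the joint distribution functions of the empirical measures to that of a
permuton implies convergence in mean of the pattern densities. -/
theorem tendsto_integral_abs_patternDensity {μ : Measure (ℝ × ℝ)} (hμ : IsPermuton μ)
    (Λ : ∀ n, Measure (Equiv.Perm (Fin n))) [∀ n, IsProbabilityMeasure (Λ n)]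
    (hΛ : ∀ x ∈ Icc (0 : ℝ) 1, ∀ y ∈ Icc (0 : ℝ) 1, Tendsto (fun n : ℕ =>
      ∫ σ, |jointCdf (empiricalMeasure σ) x y - jointCdf μ x y| ∂Λ n) atTop (𝓝 0))
    {k : ℕ} (τ : Equiv.Perm (Fin k)) :
    Tendsto (fun n : ℕ => ∫ σ, |patternDensity τ σ - permutonPatternDensity τ μ| ∂Λ n)
      atTop (𝓝 0) := by
  have := hμ.isProbabilityMeasure
  have hcell : ∀ M : ℕ, Tendsto (fun n : ℕ => ∑ c, ∫ σ, |(gridLaw M (empiricalMeasure σ)).real {c} -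
      (gridLaw M μ).real {c}| ∂Λ n) atTop (𝓝 0) := by
    intro M
    rw [← Finset.sum_const_zero (s := (Finset.univ : Finset (Fin (M + 1) × Fin (M + 1))))]
    refine tendsto_finsetSum _ fun c _ => ?_
    have hM : (0 : ℝ) < (M : ℝ) + 1 := by positivity
    have hlo : ∀ j : Fin (M + 1), (j : ℝ) / ((M : ℝ) + 1) ∈ Icc (0 : ℝ) 1 := fun j =>
      ⟨by positivity, (div_le_one hM).2 (by exact_mod_cast j.2.le)⟩
    have hhi : ∀ j : Fin (M + 1), ((j : ℝ) + 1) / ((M : ℝ) + 1) ∈ Icc (0 : ℝ) 1 := fun j =>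
      ⟨by positivity, (div_le_one hM).2 (by exact_mod_cast j.2)⟩
    have hlim := ((hΛ _ (hhi c.1) _ (hhi c.2)).add (hΛ _ (hhi c.1) _ (hlo c.2))).add
      ((hΛ _ (hlo c.1) _ (hhi c.2)).add (hΛ _ (hlo c.1) _ (hlo c.2)))
    simp only [add_zero] at hlim
    refine tendsto_of_tendsto_of_tendsto_of_le_of_le' tendsto_const_nhds hlim
      (Eventually.of_forall fun n => integral_nonneg fun σ => abs_nonneg _) ?_
    filter_upwards [eventually_gt_atTop 0] with n hn
    rw [← integral_add Integrable.of_finite Integrable.of_finite,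
      ← integral_add Integrable.of_finite Integrable.of_finite,
      ← integral_add Integrable.of_finite Integrable.of_finite]
    refine integral_mono Integrable.of_finite Integrable.of_finite fun σ => ?_
    have := isProbabilityMeasure_empiricalMeasure σ hn
    simp only
    rw [gridLaw_real_singleton (empiricalMeasure_ae_mem σ), gridLaw_real_singleton hμ.ae_mem]
    exact abs_alternating_sub_le _ _ _ _ _ _ _ _
  -- the proportion of `k`-tuples without repetition tends to one
  have hratio : Tendsto (fun n : ℕ => |((n.descFactorial k : ℝ) / (n : ℝ) ^ k)⁻¹ - 1|)
      atTop (𝓝 0) := by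
    have h := (Asymptotics.isEquivalent_iff_tendsto_one (by
      filter_upwards [eventually_gt_atTop 0] with n hn
      positivity)).1 (isEquivalent_descFactorial k)
    have h2 := ((h.inv₀ one_ne_zero).sub_const 1).abs
    simpa using h2
  rw [tendsto_order]
  refine ⟨fun a ha => Eventually.of_forall fun n =>
    ha.trans_le (integral_nonneg fun σ => abs_nonneg _), fun ε hε => ?_⟩
  obtain ⟨M, hM⟩ : ∃ M : ℕ, 4 * (k : ℝ) ^ 2 * (1 / ((M : ℝ) + 1)) < ε / 3 := by
    have h := (tendsto_one_div_add_atTop_nhds_zero_nat (𝕜 := ℝ)).const_mul (4 * (k : ℝ) ^ 2)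
    rw [mul_zero] at h
    exact (h.eventually (gt_mem_nhds (by positivity))).exists
  set K : ℝ := 2 * k ^ 2 + (Fintype.card (Fin (M + 1) × Fin (M + 1)) : ℝ) ^ k * k
  have hlim := (hcell M).const_mul K
  rw [mul_zero] at hlim
  filter_upwards [hlim.eventually (gt_mem_nhds (show 0 < ε / 3 by positivity)),
    hratio.eventually (gt_mem_nhds (show 0 < ε / 3 by positivity)),
    eventually_gt_atTop 0, eventually_ge_atTop k] with n hn1 hn2 hn0 hnk
  set r : ℝ := (n.descFactorial k : ℝ) / (n : ℝ) ^ k with hr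
  have hr0 : r ≠ 0 := by
    have h1 : (n.descFactorial k : ℝ) ≠ 0 := by
      exact_mod_cast (Nat.descFactorial_pos.2 hnk).ne'
    have h2 : (n : ℝ) ≠ 0 := by exact_mod_cast hn0.ne'
    exact div_ne_zero h1 (pow_ne_zero _ h2)
  have hpt : ∀ σ : Equiv.Perm (Fin n), |patternDensity τ σ - permutonPatternDensity τ μ| ≤
      |r⁻¹ - 1| + 4 * (k : ℝ) ^ 2 * (1 / ((M : ℝ) + 1)) +
        K * ∑ c, |(gridLaw M (empiricalMeasure σ)).real {c} - (gridLaw M μ).real {c}| := by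
    intro σ
    have := isProbabilityMeasure_empiricalMeasure σ hn0
    have h1 := hμ.abs_permutonPatternDensity_sub_le (empiricalMeasure σ) τ M
    have h2 := permutonPatternDensity_empiricalMeasure σ τ hn0 hnk
    set T := permutonPatternDensity τ (empiricalMeasure σ)
    have hT : T ∈ Icc (0 : ℝ) 1 := ⟨measureReal_nonneg, measureReal_le_one⟩
    have h3 : patternDensity τ σ - T = T * (r⁻¹ - 1) := by
      rw [h2, ← hr]
      field_simp
    have h4 : |patternDensity τ σ - T| ≤ |r⁻¹ - 1| := by
      rw [h3, abs_mul, abs_of_nonneg hT.1]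
      exact mul_le_of_le_one_left (abs_nonneg _) hT.2
    have h5 := abs_sub_le (patternDensity τ σ) T (permutonPatternDensity τ μ)
    linarith
  calc _ ≤ ∫ σ, (|r⁻¹ - 1| + 4 * (k : ℝ) ^ 2 * (1 / ((M : ℝ) + 1)) +
        K * ∑ c, |(gridLaw M (empiricalMeasure σ)).real {c} - (gridLaw M μ).real {c}|) ∂Λ n :=
        integral_mono Integrable.of_finite Integrable.of_finite hpt
    _ = |r⁻¹ - 1| + 4 * (k : ℝ) ^ 2 * (1 / ((M : ℝ) + 1)) + K * ∑ c,
        ∫ σ, |(gridLaw M (empiricalMeasure σ)).real {c} - (gridLaw M μ).real {c}| ∂Λ n := by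
        rw [integral_add Integrable.of_finite Integrable.of_finite, integral_const_mul,
          integral_finsetSum _ fun c _ => Integrable.of_finite]
        simp
    _ < ε := by linarith

/-! ### The density of inversions -/

/-- The tail integral `∫ₓ¹ g` of `g` (extended by its values at the end points). -/
noncomputable def tailIntegral (g : ℝ → ℝ) (x : ℝ) : ℝ := ∫ z in x..1, clampExt g z

theorem tailIntegral_one (g : ℝ → ℝ) : tailIntegral g 1 = 0 := intervalIntegral.integral_same

theorem intervalIntegrable_of_mem_Icc {f : ℝ → ℝ} (hf : ContinuousOn f (Ico 0 1))
    (hb : ∀ x ∈ Ico (0 : ℝ) 1, f x ∈ Icc (0 : ℝ) 1) : IntervalIntegrable f volume 0 1 := by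
  rw [intervalIntegrable_iff_integrableOn_Ico_of_le zero_le_one]
  refine Integrable.of_bound (hf.aestronglyMeasurable measurableSet_Ico) 1 ?_
  filter_upwards [ae_restrict_mem measurableSet_Ico] with x hx
  rw [Real.norm_eq_abs, abs_le]
  exact ⟨by linarith [(hb x hx).1], (hb x hx).2⟩

theorem permuton_ae_mem (g : ℝ → ℝ) :
    ∀ᵐ p ∂permuton g, p ∈ Ico (0 : ℝ) 1 ×ˢ Ico (0 : ℝ) 1 :=
  (withDensity_absolutelyContinuous _ _).ae_le
    (ae_restrict_mem (measurableSet_Ico.prod measurableSet_Ico))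

theorem setLIntegral_ofReal_id :
    ∫⁻ s in Ico (0 : ℝ) 1, ENNReal.ofReal s = ENNReal.ofReal (1 / 2) := by
  rw [setLIntegral_Ico_ofReal_deriv zero_le_one (H := fun s => s ^ 2 / 2) (by fun_prop)]
  · norm_num
  · intro x _
    simpa using (hasDerivAt_pow 2 x).div_const 2
  · exact fun x hx => hx.1.le

theorem mem_patternSet_swap {α : Type*} [LinearOrder α] (p : Fin 2 → α × α) :
    p ∈ patternSet α (Equiv.swap (0 : Fin 2) 1) ↔
      ((p 0).1 < (p 1).1 ∧ (p 1).2 < (p 0).2) ∨ ((p 1).1 < (p 0).1 ∧ (p 0).2 < (p 1).2) := by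
  constructor
  · rintro ⟨s, h1, h2⟩
    have hs : s 0 ≠ s 1 := s.injective.ne (by decide)
    have h1' := h1 0 1 (by decide)
    have h2' := (h2 1 0).2 (by decide)
    rcases Fin.exists_fin_two.1 ⟨s 0, rfl⟩ with h0 | h0 <;>
      rcases Fin.exists_fin_two.1 ⟨s 1, rfl⟩ with h1 | h1 <;> rw [h0, h1] at hs h1' h2'
    · exact absurd rfl hs
    · exact Or.inl ⟨h1', h2'⟩
    · exact Or.inr ⟨h1', h2'⟩
    · exact absurd rfl hs
  · rintro (⟨h1, h2⟩ | ⟨h1, h2⟩)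
    · refine ⟨1, ?_, ?_⟩
      · simp [Fin.forall_fin_two, h1]
      · simp [Fin.forall_fin_two, h2, h2.le]
    · refine ⟨Equiv.swap 0 1, ?_, ?_⟩
      · simp [Fin.forall_fin_two, h1]
      · simp [Fin.forall_fin_two, h2, h2.le]

namespace Admissible

variable {g : ℝ → ℝ}

theorem hasDerivAt_tailIntegral (hg : Admissible g) {x : ℝ} (hx : x ∈ Icc (0 : ℝ) 1) :
    HasDerivAt (tailIntegral g) (-g x) x := by
  rw [← clampExt_of_mem (g := g) hx]
  exact intervalIntegral.integral_hasDerivAt_left (hg.continuous_clampExt.intervalIntegrable _ _)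
    (hg.continuous_clampExt.stronglyMeasurableAtFilter _ _) hg.continuous_clampExt.continuousAt

theorem continuousOn_tailIntegral (hg : Admissible g) : ContinuousOn (tailIntegral g) (Icc 0 1) :=
  fun _ hx => (hg.hasDerivAt_tailIntegral hx).continuousAt.continuousWithinAt

theorem tailIntegral_mem (hg : Admissible g) {x : ℝ} (hx : x ∈ Icc (0 : ℝ) 1) :
    0 ≤ tailIntegral g x ∧ tailIntegral g x ≤ (1 - x) * g x := by
  rcases hx.2.eq_or_lt with rfl | hx1
  · simp [tailIntegral_one]
  obtain ⟨ξ, hξ, h⟩ := exists_hasDerivAt_eq_slope (tailIntegral g) (fun x => -g x) hx1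
    (hg.continuousOn_tailIntegral.mono (Icc_subset_Icc_left hx.1))
    fun z hz => hg.hasDerivAt_tailIntegral ⟨hx.1.trans hz.1.le, hz.2.le⟩
  have h1 : (0 : ℝ) < 1 - x := sub_pos.2 hx1
  have hξm : ξ ∈ Icc (0 : ℝ) 1 := ⟨hx.1.trans hξ.1.le, hξ.2.le⟩
  rw [tailIntegral_one, zero_sub, neg_div, neg_inj, eq_div_iff h1.ne'] at h
  have h2 := hg.nonneg hξm
  have h3 := hg.strictAntiOn.antitoneOn hx hξm hξ.1.le
  constructor <;> nlinarith

/-- The integrand of the density of inversions, after an integration by parts. -/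
theorem tailIntegral_div_mem (hg : Admissible g) {x : ℝ} (hx : x ∈ Ico (0 : ℝ) 1) :
    tailIntegral g x / g x ∈ Icc (0 : ℝ) 1 := by
  have h := hg.tailIntegral_mem (Ico_subset_Icc_self hx)
  refine ⟨div_nonneg h.1 (hg.pos hx).le, (div_le_one (hg.pos hx)).2 ?_⟩
  nlinarith [hg.pos hx, hx.1]

theorem uExt_mul_le (hg : Admissible g) {x : ℝ} (hx : x ∈ Ico (0 : ℝ) 1) :
    uExt g x * g x ≤ x := by
  rcases hx.1.eq_or_lt with rfl | hx0
  · simp [uExt_zero]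
  obtain ⟨ξ, hξ, h⟩ := exists_hasDerivAt_eq_slope (uExt g) (fun x => 1 / clampExt g x) hx0
    (hg.continuousOn_uExt.mono fun z hz => hz.2.trans_lt hx.2)
    fun z hz => hg.hasDerivAt_uExt (hz.2.trans hx.2)
  have hξm : ξ ∈ Ico (0 : ℝ) 1 := ⟨hξ.1.le, hξ.2.trans hx.2⟩
  rw [clampExt_of_mem (Ico_subset_Icc_self hξm), uExt_zero, sub_zero, sub_zero,
    eq_div_iff hx0.ne'] at h
  rw [← h, one_div_mul_eq_div, div_mul_eq_mul_div, div_le_iff₀ (hg.pos hξm)]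
  exact mul_le_mul_of_nonneg_left (hg.strictAntiOn.antitoneOn (Ico_subset_Icc_self hξm)
    (Ico_subset_Icc_self hx) hξ.2.le) hx.1

theorem intervalIntegrable_tailIntegral_div (hg : Admissible g) :
    IntervalIntegrable (fun x => tailIntegral g x / g x) volume 0 1 :=
  intervalIntegrable_of_mem_Icc ((hg.continuousOn_tailIntegral.mono Ico_subset_Icc_self).div
    (hg.continuousOn.mono Ico_subset_Icc_self) fun _ hx => (hg.pos hx).ne')
    fun _ hx => hg.tailIntegral_div_mem hx

theorem integral_uFun_mul (hg : Admissible g) :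
    ∫ s in (0 : ℝ)..1, uFun g s * g s = ∫ s in (0 : ℝ)..1, tailIntegral g s / g s := by
  have hu : ContinuousOn (uExt g) (Ico 0 1) := hg.continuousOn_uExt.mono fun z hz => hz.2
  have hint : IntervalIntegrable (fun x => uExt g x * g x) volume 0 1 :=
    intervalIntegrable_of_mem_Icc (hu.mul (hg.continuousOn.mono Ico_subset_Icc_self))
      fun x hx => ⟨mul_nonneg (hg.uExt_nonneg hx) (hg.pos hx).le,
        (hg.uExt_mul_le hx).trans hx.2.le⟩
  have hcont : ContinuousOn (fun x => uExt g x * tailIntegral g x) (Icc 0 1) := by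
    intro x hx
    rcases hx.2.lt_or_eq with hx1 | rfl
    · exact (((hg.hasDerivAt_uExt hx1).continuousAt).mul
        (hg.hasDerivAt_tailIntegral hx).continuousAt).continuousWithinAt
    · have hle : ∀ z ∈ Icc (0 : ℝ) 1, 0 ≤ uExt g z * tailIntegral g z ∧
          uExt g z * tailIntegral g z ≤ 1 - z := by
        intro z hz
        rcases hz.2.lt_or_eq with hz1 | rfl
        · have h1 := hg.tailIntegral_mem hz
          have h2 := hg.uExt_nonneg ⟨hz.1, hz1⟩
          have h3 := hg.uExt_mul_le ⟨hz.1, hz1⟩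
          refine ⟨mul_nonneg h2 h1.1, (mul_le_mul_of_nonneg_left h1.2 h2).trans ?_⟩
          nlinarith
        · simp [tailIntegral_one]
      rw [ContinuousWithinAt, tailIntegral_one, mul_zero]
      refine tendsto_of_tendsto_of_tendsto_of_le_of_le' (g := fun _ => 0) (h := fun z => 1 - z)
        tendsto_const_nhds ?_ ?_ ?_
      · have : Tendsto (fun z : ℝ => 1 - z) (𝓝 1) (𝓝 (1 - 1)) :=
          (continuous_const.sub continuous_id).tendsto 1
        rw [sub_self] at this
        exact this.mono_left nhdsWithin_le_nhds
      · filter_upwards [self_mem_nhdsWithin] with z hz using (hle z hz).1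
      · filter_upwards [self_mem_nhdsWithin] with z hz using (hle z hz).2
  have h := intervalIntegral.integral_eq_sub_of_hasDerivAt_of_le zero_le_one hcont
    (f' := fun x => tailIntegral g x / g x - uExt g x * g x) (fun x hx => by
      have hx' := Ioo_subset_Icc_self hx
      refine ((hg.hasDerivAt_uExt hx.2).mul (hg.hasDerivAt_tailIntegral hx')).congr_deriv ?_
      rw [clampExt_of_mem hx']
      ring) (hg.intervalIntegrable_tailIntegral_div.sub hint)
  rw [intervalIntegral.integral_sub hg.intervalIntegrable_tailIntegral_div hint, uExt_zero,
    tailIntegral_one, mul_zero, zero_mul, sub_zero, sub_eq_zero] at h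
  rw [h]
  refine intervalIntegral.integral_congr fun s hs => ?_
  rw [uIcc_of_le zero_le_one] at hs
  simp only [uExt_of_mem g hs]

theorem setLIntegral_cupCdf_mul_density (hg : Admissible g) {s : ℝ} (hs : s ∈ Ico (0 : ℝ) 1) :
    ∫⁻ t in Ico 0 1, ENNReal.ofReal (cupCdf g s t * density g s t) =
      ENNReal.ofReal (s + tailIntegral g s / g s) := by
  have hpos := hg.pos hs
  have hmaps : MapsTo (cupCdf g s) (Icc 0 1) (Icc 0 1) := fun t ht =>
    hg.cupCdf_mem_Icc (Ico_subset_Icc_self hs) ht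
  have hVc := hg.continuousOn_cupCdf_right hs
  rw [setLIntegral_Ico_ofReal_deriv zero_le_one (H := fun t =>
    -(cupCdf g s t * g (cupCdf g s t) + tailIntegral g (cupCdf g s t)) / g s)]
  · rw [hg.cupCdf_zero_right hs, cupCdf_one_right, tailIntegral_one, hg.map_one]
    congr 1
    field_simp
    ring
  · exact ((hVc.mul (hg.continuousOn.comp hVc hmaps)).add
      (hg.continuousOn_tailIntegral.comp hVc hmaps)).neg.div_const _
  · intro t ht
    have hV : cupCdf g s t ∈ Ioo (0 : ℝ) 1 :=
      ⟨ht.1.trans_le (hg.le_cupCdf_right hs (Ioo_subset_Ico_self ht)),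
        (hg.cupCdf_mem hs (Ioo_subset_Ico_self ht)).2⟩
    have hdV := hg.hasDerivAt_cupCdf_right hs ht
    refine (((hdV.mul ((hg.hasDerivAt hV).comp t hdV)).add
      ((hg.hasDerivAt_tailIntegral (Ioo_subset_Icc_self hV)).comp t hdV)).neg.div_const
        (g s)).congr_deriv ?_
    have := (hg.pos (Ioo_subset_Ico_self ht)).ne'
    rw [density]
    simp only [Function.comp_apply]
    field_simp
    ring
  · exact fun t ht => mul_nonneg (hg.cupCdf_mem hs (Ioo_subset_Ico_self ht)).1
      (hg.density_nonneg hs (Ioo_subset_Ico_self ht))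

theorem lintegral_cupCdf_permuton (hg : Admissible g) :
    ∫⁻ p, ENNReal.ofReal (cupCdf g p.1 p.2) ∂permuton g =
      ENNReal.ofReal (1 / 2) + ENNReal.ofReal (∫ s in (0 : ℝ)..1, tailIntegral g s / g s) := by
  have hVm : AEMeasurable (fun p : ℝ × ℝ => ENNReal.ofReal (cupCdf g p.1 p.2))
      ((volume : Measure (ℝ × ℝ)).restrict (Ico 0 1 ×ˢ Ico 0 1)) :=
    (hg.continuousOn_cupCdf_uncurry.aemeasurable
      (measurableSet_Ico.prod measurableSet_Ico)).ennreal_ofReal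
  have hprod : ((volume : Measure (ℝ × ℝ)).restrict (Ico 0 1 ×ˢ Ico 0 1)) =
      (volume.restrict (Ico (0 : ℝ) 1)).prod (volume.restrict (Ico (0 : ℝ) 1)) := by
    rw [Measure.volume_eq_prod, Measure.prod_restrict]
  rw [permuton, lintegral_withDensity_eq_lintegral_mul₀ hg.aemeasurable_density hVm]
  have hm := hg.aemeasurable_density.mul hVm
  rw [hprod] at hm ⊢
  rw [lintegral_prod _ hm]
  have hinner : ∀ s ∈ Ico (0 : ℝ) 1, ∫⁻ t in Ico 0 1,
      ((fun p : ℝ × ℝ => ENNReal.ofReal (density g p.1 p.2)) *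
        fun p : ℝ × ℝ => ENNReal.ofReal (cupCdf g p.1 p.2)) (s, t) =
      ENNReal.ofReal s + ENNReal.ofReal (tailIntegral g s / g s) := by
    intro s hs
    rw [← ENNReal.ofReal_add hs.1 (hg.tailIntegral_div_mem hs).1,
      ← hg.setLIntegral_cupCdf_mul_density hs]
    refine setLIntegral_congr_fun measurableSet_Ico fun t ht => ?_
    simp only [Pi.mul_apply]
    rw [← ENNReal.ofReal_mul (hg.density_nonneg hs ht), mul_comm]
  rw [setLIntegral_congr_fun measurableSet_Ico hinner,
    lintegral_add_left ENNReal.measurable_ofReal, setLIntegral_ofReal_id]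
  have hint := (intervalIntegrable_iff_integrableOn_Ico_of_le zero_le_one).1
    hg.intervalIntegrable_tailIntegral_div
  rw [intervalIntegral.integral_of_le zero_le_one, ← Measure.restrict_congr_set Ico_ae_eq_Ioc,
    ofReal_integral_eq_lintegral_ofReal hint]
  exact (ae_restrict_mem measurableSet_Ico).mono fun s hs => (hg.tailIntegral_div_mem hs).1

theorem lintegral_snd_permuton (hg : Admissible g) :
    ∫⁻ p, ENNReal.ofReal p.2 ∂permuton g = ENNReal.ofReal (1 / 2) := by
  rw [← lintegral_map (f := fun y : ℝ => ENNReal.ofReal y) ENNReal.measurable_ofReal measurable_snd,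
    hg.isPermuton_permuton.map_snd, ← Measure.restrict_congr_set Ico_ae_eq_Icc,
    setLIntegral_ofReal_id]

/-- The measure of an upper left quadrant. -/
theorem permuton_Iio_prod_Ioi (hg : Admissible g) {x y : ℝ} (hx : x ∈ Ico (0 : ℝ) 1)
    (hy : y ∈ Ico (0 : ℝ) 1) :
    permuton g (Iio x ×ˢ Ioi y) = ENNReal.ofReal (cupCdf g x y - y) := by
  have := hg.isPermuton_permuton.isProbabilityMeasure
  have hx' := Ico_subset_Icc_self hx
  have hy' := Ico_subset_Icc_self hy
  have hnull : (permuton g).real ({x} ×ˢ Ioi y) = 0 := by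
    rw [measureReal_def, ENNReal.toReal_eq_zero_iff]
    left
    refine measure_mono_null (prod_mono_right (subset_univ _)) ?_
    rw [hg.permuton_prod_univ (measurableSet_singleton x)]
    exact measure_mono_null inter_subset_left Real.volume_singleton
  have h1 : (permuton g).real (Iic x ×ˢ Ioi y) = (permuton g).real (Iio x ×ˢ Ioi y) := by
    rw [← Iio_union_right, union_prod, measureReal_union _
      ((measurableSet_singleton x).prod measurableSet_Ioi), hnull, add_zero]
    exact Disjoint.set_prod_left (by simp) _ _
  have h2 : (permuton g).real (Iic x ×ˢ Iic y) + (permuton g).real (Iic x ×ˢ Ioi y) =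
      (permuton g).real (Iic x ×ˢ univ) := by
    rw [← measureReal_union (Disjoint.set_prod_right (Iic_disjoint_Ioi le_rfl) _ _)
      (measurableSet_Iic.prod measurableSet_Ioi), ← prod_union, Iic_union_Ioi]
  have h3 : (permuton g).real (Iic x ×ˢ univ) = x := by
    rw [measureReal_def, hg.permuton_prod_univ measurableSet_Iic,
      measure_congr (Iic_inter_Ico_ae_eq hx.2.le), Real.volume_Ico, sub_zero,
      ENNReal.toReal_ofReal hx.1]
  have h4 := hg.jointCdf_permuton hx' hy'
  rw [jointCdf] at h4
  rw [← ofReal_measureReal]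
  congr 1
  linarith

/-- The probability that, of two independent points of law `μ_g`, the first lies above and to the
left of the second. It is obtained as the difference of the means of `V_g` and of the second
coordinate; adding the latter to both sides avoids subtractions of extended reals. -/
theorem lintegral_quadrant (hg : Admissible g) :
    ∫⁻ q, permuton g (Iio q.1 ×ˢ Ioi q.2) ∂permuton g =
      ENNReal.ofReal (∫ s in (0 : ℝ)..1, tailIntegral g s / g s) := by
  have h : ∫⁻ q, permuton g (Iio q.1 ×ˢ Ioi q.2) ∂permuton g + ENNReal.ofReal (1 / 2) =
      ENNReal.ofReal (∫ s in (0 : ℝ)..1, tailIntegral g s / g s) + ENNReal.ofReal (1 / 2) := by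
    rw [add_comm (ENNReal.ofReal (∫ s in (0 : ℝ)..1, _)), ← hg.lintegral_cupCdf_permuton,
      ← hg.lintegral_snd_permuton,
      ← lintegral_add_right _ measurable_snd.ennreal_ofReal]
    refine lintegral_congr_ae ?_
    filter_upwards [permuton_ae_mem g] with q hq
    have hle := hg.le_cupCdf_right hq.1 hq.2
    rw [hg.permuton_Iio_prod_Ioi hq.1 hq.2, ← ENNReal.ofReal_add (sub_nonneg.2 hle) hq.2.1,
      sub_add_cancel]
  exact (ENNReal.add_left_inj ENNReal.ofReal_ne_top).1 h

theorem permutonPatternDensity_swap (hg : Admissible g) :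
    permutonPatternDensity (Equiv.swap (0 : Fin 2) 1) (permuton g) =
      2 * ∫ s in (0 : ℝ)..1, tailIntegral g s / g s := by
  set μ := permuton g with hμ
  have := hg.isPermuton_permuton.isProbabilityMeasure
  set I := ∫ s in (0 : ℝ)..1, tailIntegral g s / g s with hI
  have hI0 : 0 ≤ I := intervalIntegral.integral_nonneg_of_ae_restrict zero_le_one (by
    rw [← Measure.restrict_congr_set Ico_ae_eq_Icc]
    exact (ae_restrict_mem measurableSet_Ico).mono fun s hs => (hg.tailIntegral_div_mem hs).1)
  set A : Set ((ℝ × ℝ) × (ℝ × ℝ)) := {r | r.1.1 < r.2.1 ∧ r.2.2 < r.1.2} with hA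
  have hAm : MeasurableSet A :=
    (measurableSet_lt (measurable_fst.comp measurable_fst)
      (measurable_fst.comp measurable_snd)).inter
      (measurableSet_lt (measurable_snd.comp measurable_snd)
        (measurable_snd.comp measurable_fst))
  have hA1 : (μ.prod μ) A = ENNReal.ofReal I := by
    rw [Measure.prod_apply_symm hAm, ← hg.lintegral_quadrant]
    rfl
  have hA2 : (μ.prod μ) (Prod.swap ⁻¹' A) = ENNReal.ofReal I := by
    rw [← hA1]
    exact Measure.measurePreserving_swap.measure_preimage hAm.nullMeasurableSet
  have hset : patternSet ℝ (Equiv.swap (0 : Fin 2) 1) =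
      MeasurableEquiv.finTwoArrow ⁻¹' (A ∪ Prod.swap ⁻¹' A) := by
    ext p
    rw [mem_patternSet_swap]
    rfl
  have hdisj : Disjoint A (Prod.swap ⁻¹' A) := by
    rw [Set.disjoint_left]
    rintro r ⟨h1, _⟩ ⟨h2, _⟩
    exact lt_asymm h1 h2
  rw [permutonPatternDensity_eq, hset, measureReal_def,
    (measurePreserving_finTwoArrow μ).measure_preimage
      (hAm.union (measurable_swap hAm)).nullMeasurableSet,
    measure_union hdisj (measurable_swap hAm), hA1, hA2, ← ENNReal.ofReal_add hI0 hI0,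
    ENNReal.toReal_ofReal (add_nonneg hI0 hI0), two_mul]

end Admissible

/-! ### The card-minimum model -/

theorem admissible_one_sub_pow {k : ℕ} (hk : 0 < k) : Admissible fun x : ℝ => (1 - x) ^ k where
  contDiffOn := ((contDiff_const.sub contDiff_id).pow k).contDiffOn
  strictAntiOn := fun x _ y hy hxy =>
    pow_lt_pow_left₀ (by linarith) (sub_nonneg.2 hy.2) hk.ne'
  map_zero := by simp
  map_one := by simp [hk.ne']

theorem tailIntegral_one_sub_pow {k : ℕ} {x : ℝ} (hx : x ∈ Icc (0 : ℝ) 1) :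
    tailIntegral (fun x : ℝ => (1 - x) ^ k) x = (1 - x) ^ (k + 1) / (k + 1) := by
  have h1 : tailIntegral (fun x : ℝ => (1 - x) ^ k) x = ∫ z in x..1, (1 - z) ^ k := by
    refine intervalIntegral.integral_congr fun z hz => ?_
    rw [uIcc_of_le hx.2] at hz
    exact clampExt_of_mem (g := fun x : ℝ => (1 - x) ^ k) ⟨hx.1.trans hz.1, hz.2⟩
  rw [h1, intervalIntegral.integral_comp_sub_left (fun z => z ^ k) 1, integral_pow]
  simp

theorem integral_tailIntegral_one_sub_pow (k : ℕ) :
    ∫ s in (0 : ℝ)..1, tailIntegral (fun x : ℝ => (1 - x) ^ k) s / (1 - s) ^ k =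
      1 / (2 * ((k : ℝ) + 1)) := by
  have h : ∫ s in (0 : ℝ)..1, tailIntegral (fun x : ℝ => (1 - x) ^ k) s / (1 - s) ^ k =
      ∫ s in (0 : ℝ)..1, (1 - s) / ((k : ℝ) + 1) := by
    rw [intervalIntegral.integral_of_le zero_le_one, intervalIntegral.integral_of_le zero_le_one,
      ← Measure.restrict_congr_set Ico_ae_eq_Ioc]
    refine setIntegral_congr_fun measurableSet_Ico fun s hs => ?_
    have hs1 : (1 - s) ≠ 0 := (sub_pos.2 hs.2).ne'
    have hk : (k : ℝ) + 1 ≠ 0 := by positivity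
    rw [tailIntegral_one_sub_pow (Ico_subset_Icc_self hs)]
    field_simp
    ring
  rw [h, intervalIntegral.integral_div, intervalIntegral.integral_comp_sub_left (fun z => z) 1,
    integral_id]
  have hk : (k : ℝ) + 1 ≠ 0 := by positivity
  field_simp
  norm_num

theorem measure_fin_ext {m : ℕ} (μ ν : Measure (Fin m)) [IsFiniteMeasure μ] [IsFiniteMeasure ν]
    (h : ∀ R ≤ m, μ.real {x | R ≤ (x : ℕ)} = ν.real {x | R ≤ (x : ℕ)}) : μ = ν := by
  refine Measure.ext_of_singleton fun l => ?_
  have key : ∀ μ : Measure (Fin m), ∀ [IsFiniteMeasure μ], μ.real {l} =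
      μ.real {x | (l : ℕ) ≤ (x : ℕ)} - μ.real {x | (l : ℕ) + 1 ≤ (x : ℕ)} := fun μ _ => by
    have : {x : Fin m | (l : ℕ) ≤ (x : ℕ)} = ({l} ∪ {x | (l : ℕ) + 1 ≤ (x : ℕ)} : Set (Fin m)) := by
      ext x
      simp only [mem_ofPred_eq, mem_union, mem_singleton_iff, Fin.ext_iff]
      omega
    rw [this, measureReal_union _ MeasurableSet.of_discrete]
    · ring
    · simp
  rw [← measureReal_eq_measureReal_iff, key μ, key ν, h _ l.2.le, h _ l.2]

theorem isProbabilityMeasure_minUniformLaw {k : ℕ} (hk : 0 < k) {m : ℕ} (hm : 0 < m) :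
    IsProbabilityMeasure (minUniformLaw k hk m) := by
  have : Nonempty (Fin m) := ⟨⟨0, hm⟩⟩
  exact Measure.isProbabilityMeasure_map (measurable_of_finite _).aemeasurable

theorem minUniformLaw_real_le {k : ℕ} (hk : 0 < k) {m R : ℕ} (hm : 0 < m) (hR : R ≤ m) :
    (minUniformLaw k hk m).real {x | R ≤ (x : ℕ)} = (((m : ℝ) - R) / m) ^ k := by
  classical
  have : Nonempty (Fin m) := ⟨⟨0, hm⟩⟩
  rw [minUniformLaw, map_measureReal_apply (measurable_of_finite _) MeasurableSet.of_discrete]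
  have hset : (fun x : Fin k → Fin m =>
      Finset.univ.inf' ⟨⟨0, hk⟩, Finset.mem_univ _⟩ x) ⁻¹' {x | R ≤ (x : ℕ)} =
      univ.pi fun _ => {x : Fin m | R ≤ (x : ℕ)} := by
    ext x
    simp only [mem_preimage, mem_ofPred_eq, mem_univ_pi]
    constructor
    · intro h a
      exact h.trans (Fin.le_def.1 (Finset.inf'_le x (Finset.mem_univ a)))
    · intro h
      obtain ⟨a, _, ha⟩ := Finset.exists_mem_eq_inf' (s := (Finset.univ : Finset (Fin k)))
        ⟨⟨0, hk⟩, Finset.mem_univ _⟩ x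
      rw [ha]
      exact h a
  rw [hset, measureReal_def, Measure.pi_pi, ENNReal.toReal_prod, Finset.prod_const,
    Finset.card_univ, Fintype.card_fin, ← measureReal_def, measureReal_uniformOn_univ,
    Fintype.card_fin]
  congr 2
  have h1 := Finset.card_filter_add_card_filter_not (s := (Finset.univ : Finset (Fin m)))
    fun j : Fin m => (j : ℕ) < R
  rw [card_filter_val_lt hR, Finset.card_univ, Fintype.card_fin] at h1
  have h2 : (Finset.univ.filter fun j : Fin m => j ∈ {x : Fin m | R ≤ (x : ℕ)}) =
      Finset.univ.filter fun j : Fin m => ¬ (j : ℕ) < R := by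
    ext j
    simp
  rw [h2, eq_sub_iff_add_eq, add_comm]
  exact_mod_cast h1

/-- The card-minimum model with parameter `k` is the `g`-random permutation for
`g x = (1 - x) ^ k`. -/
theorem kCMLaw_eq_permLaw {k : ℕ} (hk : 0 < k) (n : ℕ) :
    kCMLaw k hk n = permLaw (fun x : ℝ => (1 - x) ^ k) n := by
  have hg := admissible_one_sub_pow hk
  rw [kCMLaw, permLaw]
  congr 1
  funext i
  have hm : 0 < n - (i : ℕ) := Nat.sub_pos_of_lt i.2
  have := isProbabilityMeasure_minUniformLaw hk hm
  have := hg.isProbabilityMeasure_choiceLaw i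
  refine measure_fin_ext _ _ fun R hR => ?_
  rw [minUniformLaw_real_le hk hm hR, hg.choiceLaw_real_le i hR, ← div_pow, Nat.cast_sub i.2.le]
  congr 1
  have hn : (0 : ℝ) < n := by exact_mod_cast i.pos
  have hni : (n : ℝ) - i ≠ 0 := by
    have : (i : ℝ) < n := by exact_mod_cast i.2
    linarith
  have h1 : (1 : ℝ) - (i : ℝ) / n ≠ 0 := by
    rw [one_sub_div hn.ne']
    exact div_ne_zero hni hn.ne'
  rw [div_eq_div_iff hni h1]
  field_simp
  ring

theorem patternDensity_swap {n : ℕ} (σ : Equiv.Perm (Fin n)) :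
    patternDensity (Equiv.swap (0 : Fin 2) 1) σ = (inversions σ : ℝ) / (n.choose 2 : ℝ) := by
  classical
  rw [patternDensity, inversions]
  congr 2
  refine Finset.card_bij (fun e _ => (e 0, e 1)) ?_ ?_ ?_
  · intro e he
    obtain ⟨h1, h2⟩ := (Finset.mem_filter.1 he).2
    exact Finset.mem_filter.2 ⟨Finset.mem_univ _, h1 (by decide), (h2 1 0).2 (by decide)⟩
  · intro e _ e' _ h
    funext a
    obtain ⟨h0, h1⟩ := Prod.ext_iff.1 h
    fin_cases a
    exacts [h0, h1]
  · rintro ⟨a, b⟩ h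
    obtain ⟨h1, h2⟩ := (Finset.mem_filter.1 h).2
    simp only at h1 h2
    refine ⟨![a, b], Finset.mem_filter.2 ⟨Finset.mem_univ _, ?_, ?_⟩, rfl⟩
    · intro i j hij
      fin_cases i <;> fin_cases j <;> simp_all
    · simp [Fin.forall_fin_two, h2, h2.le]

/-! ### The law of large numbers -/

/-- Convergence in mean of a statistic of random permutations implies its convergence in
probability, whatever the probability spaces on which the permutations are defined. -/
theorem convergesInProbability_of_tendsto_integral_abs {Ω : ℕ → Type*}
    [∀ n, MeasurableSpace (Ω n)] {P : ∀ n, Measure (Ω n)}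
    {Λ : ∀ n, Measure (Equiv.Perm (Fin n))} [∀ n, IsProbabilityMeasure (Λ n)]
    {σ : (n : ℕ) → Ω n → Equiv.Perm (Fin n)} (hσ : ∀ n, 1 ≤ n → HasLaw (σ n) (Λ n) (P n))
    {X : ∀ n, Equiv.Perm (Fin n) → ℝ} {a : ℝ}
    (h : Tendsto (fun n => ∫ π, |X n π - a| ∂Λ n) atTop (𝓝 0)) :
    ConvergesInProbability P (fun n ω => X n (σ n ω)) a := by
  intro ε hε
  have h1 : Tendsto (fun n => ENNReal.ofReal (ε⁻¹ * ∫ π, |X n π - a| ∂Λ n)) atTop (𝓝 0) := by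
    have := ENNReal.tendsto_ofReal (h.const_mul ε⁻¹)
    simpa using this
  refine tendsto_of_tendsto_of_tendsto_of_le_of_le' tendsto_const_nhds h1
    (Eventually.of_forall fun n => zero_le) ?_
  filter_upwards [eventually_ge_atTop 1] with n hn
  have hlaw : P n {ω | ε ≤ |X n (σ n ω) - a|} = Λ n {π | ε ≤ |X n π - a|} := by
    rw [← (hσ n hn).map_eq, Measure.map_apply_of_aemeasurable (hσ n hn).aemeasurable
      MeasurableSet.of_discrete]
    rfl
  rw [hlaw, ← ofReal_measureReal]
  refine ENNReal.ofReal_le_ofReal ?_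
  rw [le_inv_mul_iff₀ hε]
  exact mul_meas_ge_le_integral_of_nonneg (Eventually.of_forall fun π => abs_nonneg _)
    Integrable.of_finite ε

theorem Admissible.convergesInProbability_patternDensity {g : ℝ → ℝ} (hg : Admissible g)
    {Ω : ℕ → Type*} [∀ n, MeasurableSpace (Ω n)] {P : ∀ n, Measure (Ω n)}
    {σ : (n : ℕ) → Ω n → Equiv.Perm (Fin n)}
    (hσ : ∀ n, 1 ≤ n → HasLaw (σ n) (permLaw g n) (P n)) {k : ℕ} (τ : Equiv.Perm (Fin k)) :
    ConvergesInProbability P (fun n ω => patternDensity τ (σ n ω))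
      (permutonPatternDensity τ (permuton g)) := by
  have := hg.isProbabilityMeasure_permLaw
  refine convergesInProbability_of_tendsto_integral_abs hσ
    (tendsto_integral_abs_patternDensity hg.isPermuton_permuton _ (fun x hx y hy => ?_) τ)
  rw [hg.jointCdf_permuton hx hy]
  simp only [jointCdf_empiricalMeasure _ hx.1 hy.1]
  exact hg.tendsto_integral_abs_countBelow hx hy

end GPermutation

open GPermutation

/-- Law of large numbers for pattern densities of `g`-random permutations, together with its
special case, the weak law of large numbers for inversions in the `k`-card-minimum model. -/
theorem mainTheorem3 {Ω : ℕ → Type*} [∀ n, MeasurableSpace (Ω n)] (P : ∀ n, Measure (Ω n))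
    [∀ n, IsProbabilityMeasure (P n)] :
    (∀ g : ℝ → ℝ, Admissible g →
      -- `V_g` solves the initial value problem
      (∀ y ∈ Ico (0 : ℝ) 1, cupCdf g 0 y = y ∧
        ∀ x ∈ Ico (0 : ℝ) 1, cupCdf g x y ∈ Ico (0 : ℝ) 1 ∧
          HasDerivWithinAt (fun x' => cupCdf g x' y) (g (cupCdf g x y) / g x)
            (Ico (0 : ℝ) 1) x) ∧
      -- `μ_g` is the permuton with joint distribution function `x + y - V_g(x,y)`
      (IsPermuton (permuton g) ∧ ∀ x ∈ Icc (0 : ℝ) 1, ∀ y ∈ Icc (0 : ℝ) 1,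
        jointCdf (permuton g) x y = x + y - cupCdf g x y) ∧
      -- the law of large numbers for all patterns
      (∀ σ : (n : ℕ) → Ω n → Equiv.Perm (Fin n),
        (∀ n, 1 ≤ n → HasLaw (σ n) (permLaw g n) (P n)) →
        ∀ (k : ℕ) (τ : Equiv.Perm (Fin k)),
          ConvergesInProbability P (fun n ω => patternDensity τ (σ n ω))
            (permutonPatternDensity τ (permuton g))) ∧
      -- the density of inversions of `μ_g`
      permutonPatternDensity (Equiv.swap (0 : Fin 2) 1) (permuton g) =
        2 * ∫ s in (0 : ℝ)..1, uFun g s * g s) ∧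
    -- the weak law of large numbers for inversions in the `k`-card-minimum model
    (∀ (k : ℕ) (hk : 0 < k) (σ : (n : ℕ) → Ω n → Equiv.Perm (Fin n)),
      (∀ n, 1 ≤ n → HasLaw (σ n) (kCMLaw k hk n) (P n)) →
        ConvergesInProbability P
          (fun n ω => (inversions (σ n ω) : ℝ) / (n.choose 2 : ℝ)) (1 / ((k : ℝ) + 1))) := by
  refine ⟨fun g hg => ⟨fun y hy => ⟨hg.cupCdf_zero_left hy, fun x hx =>
    ⟨hg.cupCdf_mem hx hy, hg.hasDerivWithinAt_cupCdf_left hx hy⟩⟩,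
    ⟨hg.isPermuton_permuton, fun x hx y hy => hg.jointCdf_permuton hx hy⟩,
    fun σ hσ k τ => hg.convergesInProbability_patternDensity hσ τ, ?_⟩, fun k hk σ hσ => ?_⟩
  · rw [hg.permutonPatternDensity_swap, hg.integral_uFun_mul]
  · have hg := admissible_one_sub_pow hk
    have h := hg.convergesInProbability_patternDensity
      (fun n hn => kCMLaw_eq_permLaw hk n ▸ hσ n hn) (Equiv.swap (0 : Fin 2) 1)
    rw [hg.permutonPatternDensity_swap, integral_tailIntegral_one_sub_pow] at h
    simp only [patternDensity_swap] at h
    have hk1 : (k : ℝ) + 1 ≠ 0 := by positivity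
    have hval : 2 * (1 / (2 * ((k : ℝ) + 1))) = 1 / ((k : ℝ) + 1) := by field_simp
    rwa [hval] at h
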